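/- **Theorem (Joint CLT for $(Q^{(1)}_1,Q^{(1)}_2)$).** Let $\phi_1>0$ and $0<\phi_2<1$, and let $X=(X_x)_{x\in\mathbb R^2}$ be a Gaussian intrinsic random function of order $0$ with generalized covariance $K(h)=\phi_1\Gamma(-\phi_2)\|h\|^{2\phi_2}$; that is, for all finitely many points $x_i\in\mathbb R^2$ and real coefficients $c_i$ with $\sum_i c_i=0$, the variable $\sum_i c_iX_{x_i}$ is Gaussian with mean $0$ and variance $\sum_{i,j}c_ic_jK(x_i-x_j)$. Put $\Lambda_k=\{0,\dots,k-1\}^2$ ($\Lambda_k=\emptyset$ for $k\le 0$), $e_1=(1,0)$, $e_2=(0,1)$ and, for $r\in\{1,2\}$, $t\in\mathbb Z^2$ and $n\in\mathbb N$, $$D_{[r]}X_t=X_t-X_{t+re_1}-X_{t+re_2}+X_{t+re_1+re_2},\qquad Q_r=Q_{r,n}=\frac1{|\Lambda_{n-2r}|}\sum_{t\in\Lambda_{n-2r}}(D_{[r]}X_t)^2,$$ with $Q_{r,n}:=0$ if $n\le 2r$, and put $q_r=q_{r,n}=\mathbb E[Q_{r,n}]$ and $N=n^2$. Let $\mu(\mathrm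 d\lambda)=(2\pi)^{-2}\mathrm d\lambda$, $\mathbb T^2=(-\pi,\pi]^2$, and $$g^{[r]}(\lambda)=(1-e^{ir\lambda_1})(1-e^{ir\lambda_2}),\qquad f_0(\lambda)=2^{2\phi_2+2}\,\pi\,\Gamma(1+\phi_2)\,\phi_1\,\|\lambda\|^{-(2+2\phi_2)},$$ $$f_X(\lambda)=\sum_{m\in\mathbb Z^2}f_0(\lambda+2\pi m),\qquad f_{D_1X}(\lambda)=|g^{[1]}(\lambda)|^2f_X(\lambda)$$ (the value $f_0(0)$ is immaterial and is taken to be $0$). Let $b_1\equiv 1$ and $b_2(\lambda)=16\cos^2(\lambda_1/2)\cos^2(\lambda_2/2)$. Then $b_2=|g^{[2]}|^2/|g^{[1]}|^2$ wherever $g^{[1]}\ne 0$, and $b_2\le 16$; the series defining $f_X$ converges, the variables $Q_{r,n}$ are integrable, and the functions $b_\ell b_m f_{D_1X}^2$ are $\mu$-integrable on $\mathbb T^2$; the matrix $$\Sigma_{\ell m}=2\int_{\mathbb T^2}b_\ell(\lambda)\,b_m(\lambda)\,f_{D_1X}(\lambda)^2\,\mu(\mathrm d\lambda),\qquad \ell,m\in\{1,2\},$$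 is positive semidefinite; and, as $n\to\infty$, $$\sqrt N\begin{pmatrix}Q_1-q_1\\ Q_2-q_2\end{pmatrix}\Rightarrow\mathcal N(0,\Sigma).$$ -/

import Mathlib

open MeasureTheory ProbabilityTheory Filter Topology

noncomputable section

namespace PowerLaw

/-- The Euclidean plane: both the locations of the field and the frequencies `λ` live here. -/
abbrev Plane := EuclideanSpace ℝ (Fin 2)

/-- The point of the plane with integer coordinates `t`. -/
def latticePoint (t : ℤ × ℤ) : Plane := !₂[(t.1 : ℝ), (t.2 : ℝ)]

/-- The power-law generalized covariance `K(h) = φ₁ Γ(-φ₂) ‖h‖^(2φ₂)` (for non-integer `φ₂`). -/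
def genCov (φ₁ φ₂ : ℝ) (h : Plane) : ℝ :=
  φ₁ * Real.Gamma (-φ₂) * ‖h‖ ^ (2 * φ₂)

/-- `X` is a Gaussian intrinsic random function of order `0` on the plane with generalized
covariance `K`: for every finitely supported signed measure `c` annihilating the constants, the
functional `∑ₓ c(x) X(x)` is a centred Gaussian variable with variance
`∑ₓ ∑ᵧ c(x) c(y) K(x - y)`. Since such `c` form a linear space, all these functionals are jointly
Gaussian, and their covariances are determined by polarization. -/
structure IsGaussianIRF0 {Ω : Type*} [MeasurableSpace Ω] (P : Measure Ω)
    (X : Plane → Ω → ℝ) (K : Plane → ℝ) : Prop where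
  aemeasurable : ∀ x, AEMeasurable (X x) P
  gaussian : ∀ c : Plane →₀ ℝ, (c.sum fun _ a => a) = 0 →
    HasGaussianLaw (fun ω => c.sum fun x a => a * X x ω) P
  mean : ∀ c : Plane →₀ ℝ, (c.sum fun _ a => a) = 0 →
    ∫ ω, (c.sum fun x a => a * X x ω) ∂P = 0
  variance : ∀ c : Plane →₀ ℝ, (c.sum fun _ a => a) = 0 →
    variance (fun ω => c.sum fun x a => a * X x ω) P =
      c.sum fun x a => c.sum fun y b => a * b * K (x - y)

/-- `Λ_k = {0, …, k-1}²`. -/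
def square (k : ℕ) : Finset (ℤ × ℤ) := Finset.Ico 0 (k : ℤ) ×ˢ Finset.Ico 0 (k : ℤ)

/-- The first-order bilinear difference at step `r` of the field sampled on `ℤ²`:
`X_t - X_{t + r e₁} - X_{t + r e₂} + X_{t + r e₁ + r e₂}`. -/
def bilinDiff {Ω : Type*} (X : Plane → Ω → ℝ) (r : ℕ) (t : ℤ × ℤ) (ω : Ω) : ℝ :=
  X (latticePoint t) ω - X (latticePoint (t + ((r : ℤ), 0))) ω
    - X (latticePoint (t + (0, (r : ℤ)))) ω + X (latticePoint (t + ((r : ℤ), (r : ℤ)))) ω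

/-- The quadratic variation `Q_r`, computed from the sites of `{0, …, n-1}²`: the average of the
squared bilinear differences at step `r` over `Λ_{n-2r}` (an empty square, and the value `0`, if
`n ≤ 2r`). -/
def quadVar {Ω : Type*} (X : Plane → Ω → ℝ) (r n : ℕ) (ω : Ω) : ℝ :=
  (∑ t ∈ square (n - 2 * r), bilinDiff X r t ω ^ 2) / ((square (n - 2 * r)).card : ℝ)

/-- The torus `(-π, π]²`. -/
def torus : Set Plane := {v | ∀ i, v i ∈ Set.Ioc (-Real.pi) Real.pi}

/-- The measure `μ(dλ) = (2π)⁻² dλ`. -/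
def specMeasure : Measure Plane :=
  ENNReal.ofReal ((2 * Real.pi) ^ 2)⁻¹ • (volume : Measure Plane)

/-- The spectral density on the plane of the power-law field, with respect to `μ`:
`f₀(λ) = 2^(2φ₂+2) π Γ(1+φ₂) φ₁ ‖λ‖^(-(2+2φ₂))`. This is the Fourier transform
`∫ K(h) exp(-i⟨λ,h⟩) dh` (for `λ ≠ 0`, in the sense of distributions) of the generalized covariance
`K`. -/
def planeDensity (φ₁ φ₂ : ℝ) (v : Plane) : ℝ :=
  2 ^ (2 * φ₂ + 2) * Real.pi * Real.Gamma (1 + φ₂) * φ₁ * ‖v‖ ^ (-(2 + 2 * φ₂))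

/-- The aliased (lattice) spectral density `f_X(λ) = ∑_{m ∈ ℤ²} f₀(λ + 2πm)`. -/
def latticeDensity (φ₁ φ₂ : ℝ) (v : Plane) : ℝ :=
  ∑' m : ℤ × ℤ, planeDensity φ₁ φ₂ (v + (2 * Real.pi) • latticePoint m)

/-- The symbol `g^{[r]}(λ) = (1 - e^{i r λ₁})(1 - e^{i r λ₂})` of the bilinear difference. -/
def symbol (r : ℕ) (v : Plane) : ℂ :=
  (1 - Complex.exp (Complex.I * r * v 0)) * (1 - Complex.exp (Complex.I * r * v 1))

/-- The spectral density `|g^{[1]}|² f_X` of the bilinear difference at step `1`. -/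
def diffDensity (φ₁ φ₂ : ℝ) (v : Plane) : ℝ :=
  ‖symbol 1 v‖ ^ 2 * latticeDensity φ₁ φ₂ v

/-- The symbols `b₁ ≡ 1` and `b₂(λ) = 16 cos²(λ₁/2) cos²(λ₂/2)` (indexed by `0, 1 : Fin 2`). -/
def b (l : Fin 2) (v : Plane) : ℝ :=
  if l = 0 then 1 else 16 * Real.cos (v 0 / 2) ^ 2 * Real.cos (v 1 / 2) ^ 2

/-- The limit covariance `Σ_{ℓm} = 2 ∫ b_ℓ b_m (|g^{[1]}|² f_X)² dμ` over the torus. -/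
def limitCov (φ₁ φ₂ : ℝ) : Matrix (Fin 2) (Fin 2) ℝ := fun l m =>
  2 * ∫ v in torus, b l v * b m v * diffDensity φ₁ φ₂ v ^ 2 ∂specMeasure

/-- The vector `√N (Q₁ - q₁, Q₂ - q₂)` with `N = n²` and `q_r = E[Q_r]`. -/
def normalizedVar {Ω : Type*} [MeasurableSpace Ω] (P : Measure Ω) (X : Plane → Ω → ℝ)
    (n : ℕ) (ω : Ω) : EuclideanSpace ℝ (Fin 2) :=
  Real.sqrt ((n : ℝ) ^ 2) •
    !₂[quadVar X 1 n ω - ∫ ω', quadVar X 1 n ω' ∂P, quadVar X 2 n ω - ∫ ω', quadVar X 2 n ω' ∂P]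

end PowerLaw

end

namespace PowerLaw

/-! ### Quadratic forms of Gaussian vectors -/

section GaussianQuadraticForm

open Matrix

/-! A linear combination of the two normalized variations is a centred diagonal quadratic form `∑ i,
w i * (z i ^ 2 - C i i)` in one Gaussian vector `z`, which collects the bilinear differences of both
steps. Its covariance matrix is `C`. With `R = √C` and `z = R g`, an orthonormal eigenbasis of `R *
diagonal w * R` turns the form into `∑ j, l j * (g j ^ 2 - 1)` with independent standard `g j`. Each
factor of the characteristic function is `exp (-l j ^ 2)` up to `o(l j ^ 2)`, so the product is
close to `exp (-∑ l j ^ 2)` as soon as `max |l j|` is small and `∑ l j ^ 2` stays bounded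
(`exists_norm_integral_cexp_quadratic_sub_le`).

Two facts about the spectrum supply these conditions. First, `|l j| ≤ max |w| * ‖C‖`, where `w` is
of order `1/n` and `‖C‖` is bounded uniformly in `n`, because the spectral density of the
differences is bounded: near the origin `|g^{[1]}|² f₀` is at most of order `‖λ‖ ^ (2 - 2φ₂)`, and
`φ₂ < 1` (`exists_diffDensity_le`, `exists_dotProduct_covMatrix_stencil_le`). Secondly, `∑ l j ^ 2 =
∑ w i * w j * C i j ^ 2`. By stationarity this is a normalized double sum of squared covariances
over lags, which tends to the full lag sums, and Parseval identifies those with `Σ / 2`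
(`hasSum_diffCov_sq`, `tendsto_sum_square_sub`).

The link to the spectrum is the formula `-K(h) = ∫ (1 - cos⟨h, λ⟩) f₀ dμ`. It gives the covariances
of increments of total mass zero, and `2π`-periodicity on the lattice folds them onto the torus. The
step 2 symbol is the step 1 symbol times a filter with squared modulus `b₂`. Lévy's continuity
theorem then concludes. -/

lemma integral_pow_four_gaussianReal : ∫ x, x ^ 4 ∂gaussianReal 0 1 = 3 := by
  have h := iteratedDeriv_mgf_zero (X := id) (μ := gaussianReal 0 1)
    (by simp [integrableExpSet_id_gaussianReal]) 4
  -- The moment is the fourth derivative at `0` of the moment generating function `exp (t²/2)`.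
  have e : ∀ t : ℝ, HasDerivAt (fun t : ℝ => Real.exp (t ^ 2 / 2)) (t * Real.exp (t ^ 2 / 2)) t := by
    intro t
    convert ((hasDerivAt_pow 2 t).div_const 2).exp using 1
    simp; ring
  have d1 : deriv (fun t : ℝ => Real.exp (t ^ 2 / 2)) = fun t => t * Real.exp (t ^ 2 / 2) :=
    funext fun t => (e t).deriv
  have d2 : deriv (fun t : ℝ => t * Real.exp (t ^ 2 / 2)) =
      fun t => (1 + t ^ 2) * Real.exp (t ^ 2 / 2) := funext fun t => by
    have : HasDerivAt (fun t : ℝ => t * Real.exp (t ^ 2 / 2)) _ t := (hasDerivAt_id t).mul (e t)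
    rw [this.deriv]; simp; ring
  have d3 : deriv (fun t : ℝ => (1 + t ^ 2) * Real.exp (t ^ 2 / 2)) =
      fun t => (3 * t + t ^ 3) * Real.exp (t ^ 2 / 2) := funext fun t => by
    have : HasDerivAt (fun t : ℝ => (1 + t ^ 2) * Real.exp (t ^ 2 / 2)) _ t :=
      ((hasDerivAt_pow 2 t).const_add 1).mul (e t)
    rw [this.deriv]; simp; ring
  have d4 : deriv (fun t : ℝ => (3 * t + t ^ 3) * Real.exp (t ^ 2 / 2)) 0 = 3 := by
    have : HasDerivAt (fun t : ℝ => (3 * t + t ^ 3) * Real.exp (t ^ 2 / 2)) _ 0 :=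
      (((hasDerivAt_id (0 : ℝ)).const_mul 3).add (hasDerivAt_pow 3 (0 : ℝ))).mul (e 0)
    rw [this.deriv]; simp
  rw [mgf_id_gaussianReal] at h
  simp only [zero_mul, NNReal.coe_one, one_mul, zero_add, iteratedDeriv_succ, iteratedDeriv_zero,
    d1, d2, d3, d4] at h
  rw [h]
  simp

lemma integral_sq_gaussianReal : ∫ x, x ^ 2 ∂gaussianReal 0 1 = 1 := by
  have h := variance_id_gaussianReal (μ := 0) (v := 1)
  rw [variance_eq_integral (by fun_prop)] at h
  simpa using h

lemma integrable_pow_gaussianReal (n : ℕ) : Integrable (fun x : ℝ => x ^ n) (gaussianReal 0 1) := by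
  have h := memLp_id_gaussianReal' (μ := 0) (v := 1) n (by simp)
  exact (h.integrable_norm_pow' ).mono' (by fun_prop) (by simp)

/-- The characteristic function of a centred `χ²₁` variable is `exp (-u²) + o(u²)`. -/
lemma exists_norm_integral_cexp_sq_sub_le {ε : ℝ} (hε : 0 < ε) :
    ∃ δ > 0, ∀ u : ℝ, |u| ≤ δ →
      ‖(∫ x, Complex.exp (Complex.I * (u * (x ^ 2 - 1) : ℝ)) ∂gaussianReal 0 1)
        - Complex.exp ((-u ^ 2 : ℝ) : ℂ)‖ ≤ ε * u ^ 2 := by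
  -- Since `x ^ 2` has variance `3 - 1 = 2`, division by `√2` standardizes `x ^ 2 - 1`.
  set Y : ℝ → ℝ := fun x => (x ^ 2 - 1) / √2 with hY
  have hYm : AEMeasurable Y (gaussianReal 0 1) := by fun_prop
  have h2 : √2 ^ 2 = (2 : ℝ) := Real.sq_sqrt (by norm_num)
  have i0 := integrable_pow_gaussianReal 2
  have i4 := integrable_pow_gaussianReal 4
  have h0 : (gaussianReal 0 1)[Y] = 0 := by
    simp only [hY]
    rw [integral_div, integral_sub i0 (integrable_const _), integral_sq_gaussianReal]
    simp
  have h1 : (gaussianReal 0 1)[Y ^ 2] = 1 := by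
    have : ∀ x, (Y ^ 2) x = (x ^ 4 - 2 * x ^ 2 + 1) / 2 := fun x => by
      simp only [hY, Pi.pow_apply, div_pow, h2]; ring
    simp_rw [this]
    have i42 : Integrable (fun x : ℝ => x ^ 4 - 2 * x ^ 2) (gaussianReal 0 1) :=
      i4.sub (i0.const_mul 2)
    rw [integral_div, integral_add i42 (integrable_const _),
      integral_sub i4 (i0.const_mul 2), integral_const_mul, integral_sq_gaussianReal,
      integral_pow_four_gaussianReal]
    simp; norm_num
  have T := taylor_charFun_two hYm h0 h1
  have T2 : (fun t : ℝ => Complex.exp ((-t ^ 2 / 2 : ℝ) : ℂ) - (1 - (t : ℂ) ^ 2 / 2)) =o[𝓝 0]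
      fun t : ℝ => t ^ 2 := by
    have e := (hasDerivAt_iff_isLittleO.1 (Complex.hasDerivAt_exp 0))
    simp only [Complex.exp_zero, sub_zero, smul_eq_mul, mul_one] at e
    have hc : Tendsto (fun t : ℝ => ((-t ^ 2 / 2 : ℝ) : ℂ)) (𝓝 0) (𝓝 0) := by
      have : Continuous (fun t : ℝ => ((-t ^ 2 / 2 : ℝ) : ℂ)) := by fun_prop
      simpa using this.tendsto 0
    refine ((e.comp_tendsto hc).trans_isBigO ?_).congr_left ?_
    · refine Asymptotics.IsBigO.of_bound 1 (Eventually.of_forall fun t => ?_)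
      simp only [Function.comp, Complex.norm_real, Real.norm_eq_abs, abs_div, abs_neg, one_mul]
      have := abs_nonneg (t ^ 2)
      rw [abs_of_pos (show (0 : ℝ) < 2 by norm_num)]; linarith
    · intro t; simp only [Function.comp]; push_cast; ring
  have T3 := T.sub T2
  rw [Asymptotics.isLittleO_iff] at T3
  obtain ⟨δ, hδ, hb⟩ := Metric.eventually_nhds_iff.1 (T3 (half_pos hε))
  -- The expansion is used at `√2 * u`, and `√2 < 2`; the factor `2` in `(√2 * u) ^ 2` is why it was
  -- taken with `ε / 2`.
  refine ⟨δ / 2, by positivity, fun u hu => ?_⟩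
  have hs : √2 < 2 := by
    rw [Real.sqrt_lt' (by norm_num)]; norm_num
  have key := @hb (√2 * u) (by
    rw [Real.dist_eq, sub_zero, abs_mul, abs_of_nonneg (Real.sqrt_nonneg _)]
    by_cases h : u = 0
    · simpa [h] using hδ
    · calc √2 * |u| < 2 * |u| := by gcongr
        _ ≤ δ := by linarith)
  rw [sub_sub_sub_cancel_right, charFun_apply_real, integral_map hYm (by fun_prop)] at key
  have s : (√2 * u) ^ 2 = 2 * u ^ 2 := by rw [mul_pow, h2]
  rw [s, show -(2 * u ^ 2) / 2 = -u ^ 2 by ring, Real.norm_of_nonneg (by positivity)] at key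
  refine le_trans (le_of_eq ?_) (key.trans (le_of_eq (by ring)))
  congr 3
  ext x
  congr 1
  have : ((√2 * u : ℝ) : ℂ) * (Y x : ℝ) = ((u * (x ^ 2 - 1) : ℝ) : ℂ) := by
    rw [← Complex.ofReal_mul]; congr 1
    simp only [hY]; field_simp
  rw [this, mul_comm]

/-- Telescoping: factors are exchanged one at a time, and those left over have norm at most `1`. -/
lemma norm_prod_sub_prod_le_sum {ι R : Type*} [NormedCommRing R] [NormOneClass R] (s : Finset ι)
    {f g : ι → R} (hf : ∀ i, ‖f i‖ ≤ 1) (hg : ∀ i, ‖g i‖ ≤ 1) :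
    ‖∏ i ∈ s, f i - ∏ i ∈ s, g i‖ ≤ ∑ i ∈ s, ‖f i - g i‖ := by
  classical
  induction s using Finset.induction_on with
  | empty => simp
  | insert a s ha ih =>
    rw [Finset.prod_insert ha, Finset.prod_insert ha, Finset.sum_insert ha]
    have : f a * ∏ i ∈ s, f i - g a * ∏ i ∈ s, g i =
        (f a - g a) * ∏ i ∈ s, f i + g a * (∏ i ∈ s, f i - ∏ i ∈ s, g i) := by ring
    rw [this]
    refine (norm_add_le _ _).trans (add_le_add ?_ ?_)
    · refine (norm_mul_le _ _).trans (mul_le_of_le_one_right (norm_nonneg _) ?_)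
      exact (Finset.norm_prod_le _ _).trans (Finset.prod_le_one (fun _ _ => norm_nonneg _)
        fun i _ => hf i)
    · exact (norm_mul_le _ _).trans ((mul_le_of_le_one_left (norm_nonneg _) (hg a)).trans ih)

variable {ι : Type*} [Fintype ι] [DecidableEq ι]

lemma _root_.Matrix.IsHermitian.trace_mul_self_eq_sum_sq {A : Matrix ι ι ℝ} (hA : A.IsHermitian) :
    (A * A).trace = ∑ i, hA.eigenvalues i ^ 2 := by
  conv_lhs => rw [hA.spectral_theorem, ← map_mul, Unitary.conjStarAlgAut_apply,
    Matrix.trace_mul_cycle, Unitary.coe_star_mul_self, one_mul, diagonal_mul_diagonal,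
    trace_diagonal]
  simp [pow_two]

/-- Diagonalization of a diagonal quadratic form of a centred Gaussian vector. -/
lemma exists_integral_cexp_quadratic_eq_prod {C : Matrix ι ι ℝ} (hC : C.PosSemidef) (w : ι → ℝ) :
    ∃ l : ι → ℝ, ∑ j, l j = ∑ i, w i * C i i ∧
      ∑ j, l j ^ 2 = ∑ i, ∑ j, w i * w j * C i j ^ 2 ∧
      (∀ K m : ℝ, (∀ v : ι → ℝ, v ⬝ᵥ C *ᵥ v ≤ K * ∑ i, v i ^ 2) → (∀ i, |w i| ≤ m) →
        ∀ j, |l j| ≤ m * K) ∧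
      ∫ z, Complex.exp (Complex.I * (∑ i, w i * z i ^ 2 : ℝ)) ∂multivariateGaussian 0 C =
        ∏ j, ∫ x, Complex.exp (Complex.I * (l j * x ^ 2 : ℝ)) ∂gaussianReal 0 1 := by
  -- The symmetric square root `R` of `C` sends a standard Gaussian vector to one with covariance
  -- `C`.
  open scoped MatrixOrder in
  obtain ⟨R, hR, hRR, hRT⟩ : ∃ R : Matrix ι ι ℝ, R = CFC.sqrt C ∧ R * R = C ∧ Rᵀ = R :=
    ⟨_, rfl, CFC.sqrt_mul_sqrt_self C hC.nonneg, (CFC.sqrt_nonneg C).isSelfAdjoint⟩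
  have hM : (R * diagonal w * R).IsHermitian := by
    simp [IsHermitian, hRT, mul_assoc]
  set M := R * diagonal w * R with hMdef
  have hquad : ∀ x : ι → ℝ, x ⬝ᵥ M *ᵥ x = ∑ i, w i * (R *ᵥ x) i ^ 2 := by
    intro x
    rw [hMdef, ← mulVec_mulVec, ← mulVec_mulVec, dotProduct_mulVec, ← mulVec_transpose, hRT]
    simp only [dotProduct, mulVec_diagonal]
    exact Finset.sum_congr rfl fun i _ => by ring
  have hnorm : ∀ x : ι → ℝ, ∑ i, (R *ᵥ x) i ^ 2 = x ⬝ᵥ C *ᵥ x := by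
    intro x
    rw [← hRR, ← mulVec_mulVec, dotProduct_mulVec, ← mulVec_transpose, hRT]
    simp only [dotProduct, pow_two]
  refine ⟨hM.eigenvalues, ?_, ?_, ?_, ?_⟩
  · have := hM.trace_eq_sum_eigenvalues
    simp only [RCLike.ofReal_real_eq_id, id] at this
    rw [← this, hMdef, trace_mul_comm, ← mul_assoc, hRR, trace_mul_comm]
    simp [trace, diagonal_mul]
  · rw [← hM.trace_mul_self_eq_sum_sq]
    have hCT : Cᵀ = C := hC.isHermitian
    -- Cyclicity of the trace regroups the factors `R * R` into `C`.
    have : (M * M).trace = (C * diagonal w * C * diagonal w).trace := by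
      rw [hMdef, ← hRR]
      simp only [mul_assoc]
      rw [trace_mul_comm]
      simp only [mul_assoc]
      rw [trace_mul_comm]
      simp only [mul_assoc]
    rw [this]
    simp only [trace, diag, mul_assoc]
    simp only [← mul_assoc, Matrix.mul_diagonal, Matrix.mul_apply (N := C)]
    refine Finset.sum_congr rfl fun i _ => ?_
    rw [Finset.sum_mul]
    refine Finset.sum_congr rfl fun j _ => ?_
    have : C j i = C i j := by conv_lhs => rw [← hCT, transpose_apply]
    rw [this]; ring
  -- At a unit eigenvector `u` the eigenvalue is `∑ i, w i * (R u) i ^ 2`, and `∑ i, (R u) i ^ 2 = u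
  -- ⬝ C u ≤ K`.
  · intro K m hK hm j
    have hev := hM.eigenvalues_eq j
    simp only [RCLike.re_to_real, star_trivial] at hev
    set u : ι → ℝ := ⇑(hM.eigenvectorBasis j)
    have hu : ∑ i, u i ^ 2 = 1 := by
      have := hM.eigenvectorBasis.orthonormal.1 j
      rw [EuclideanSpace.norm_eq, Real.sqrt_eq_one] at this
      simpa using this
    rw [hev, hquad]
    calc |∑ i, w i * (R *ᵥ u) i ^ 2| ≤ ∑ i, |w i * (R *ᵥ u) i ^ 2| := Finset.abs_sum_le_sum_abs _ _
      _ ≤ ∑ i, m * (R *ᵥ u) i ^ 2 := by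
        refine Finset.sum_le_sum fun i _ => ?_
        rw [abs_mul, abs_of_nonneg (sq_nonneg ((R *ᵥ u) i))]
        gcongr; exact hm i
      _ = m * (u ⬝ᵥ C *ᵥ u) := by rw [← Finset.mul_sum, hnorm]
      _ ≤ m * (K * ∑ i, u i ^ 2) := by
        have : 0 ≤ m := (abs_nonneg _).trans (hm j)
        gcongr; exact hK u
      _ = m * K := by rw [hu, mul_one]
  · set b := hM.eigenvectorBasis
    have hform : ∀ x : ι → ℝ, ∑ i, w i * (R *ᵥ ⇑(∑ j, x j • b j)) i ^ 2 =
        ∑ j, hM.eigenvalues j * x j ^ 2 := by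
      intro x
      rw [← hquad]
      have h1 : M *ᵥ ⇑(∑ j, x j • b j) =
          ⇑(∑ j, (hM.eigenvalues j * x j) • b j : EuclideanSpace ℝ ι) := by
        have : M *ᵥ ⇑(∑ j, x j • b j) = ∑ j, x j • M *ᵥ ⇑(b j) := by
          simp [Matrix.mulVec_sum, Matrix.mulVec_smul]
        rw [this]
        simp only [b, hM.mulVec_eigenvectorBasis, smul_smul, WithLp.ofLp_sum, WithLp.ofLp_smul,
          mul_comm]
      rw [h1]
      have h2 := EuclideanSpace.inner_eq_star_dotProduct
        (∑ j, (hM.eigenvalues j * x j) • b j : EuclideanSpace ℝ ι) (∑ j, x j • b j)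
      rw [star_trivial] at h2
      rw [← h2, b.orthonormal.inner_sum]
      exact Finset.sum_congr rfl fun i _ => by simp; ring
    -- By rotation invariance the standard Gaussian vector has independent standard coordinates in
    -- the eigenbasis, so the integral factorizes.
    rw [multivariateGaussian, stdGaussian_eq_map_pi_orthonormalBasis b,
      integral_map (by fun_prop) (by fun_prop),
      integral_map (Measurable.aemeasurable (by fun_prop)) (by fun_prop)]
    simp only [zero_add, Matrix.ofLp_toEuclideanCLM, ← hR, hform]
    rw [← integral_fintype_prod_eq_prod (μ := fun _ : ι => gaussianReal 0 1)
      (f := fun j x => Complex.exp (Complex.I * (hM.eigenvalues j * x ^ 2 : ℝ)))]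
    simp_rw [← Complex.exp_sum, ← Finset.mul_sum, ← Complex.ofReal_sum]

/-- **Quantitative central limit theorem** for diagonal quadratic forms of Gaussian vectors. -/
theorem exists_norm_integral_cexp_quadratic_sub_le {ε : ℝ} (hε : 0 < ε) :
    ∃ δ > 0, ∀ {ι : Type} [Fintype ι] [DecidableEq ι] {C : Matrix ι ι ℝ}, C.PosSemidef →
      ∀ (w : ι → ℝ) (K m : ℝ), (∀ v : ι → ℝ, v ⬝ᵥ C *ᵥ v ≤ K * ∑ i, v i ^ 2) →
        (∀ i, |w i| ≤ m) → m * K ≤ δ →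
        ‖(∫ z, Complex.exp (Complex.I * (∑ i, w i * (z i ^ 2 - C i i) : ℝ))
            ∂multivariateGaussian 0 C)
          - Complex.exp ((-∑ i, ∑ j, w i * w j * C i j ^ 2 : ℝ) : ℂ)‖
          ≤ ε * ∑ i, ∑ j, w i * w j * C i j ^ 2 := by
  obtain ⟨δ, hδ, hb⟩ := exists_norm_integral_cexp_sq_sub_le hε
  refine ⟨δ, hδ, fun {ι} _ _ {C} hC w K m hK hm hmK => ?_⟩
  obtain ⟨l, l1, l2, l3, l4⟩ := exists_integral_cexp_quadratic_eq_prod hC w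
  have hcentre : ∀ (a c : ℝ), Complex.exp (Complex.I * (a - c : ℝ)) =
      Complex.exp (Complex.I * (a : ℝ)) * Complex.exp (-(Complex.I * (c : ℝ))) := by
    intro a c
    rw [← Complex.exp_add]; congr 1; push_cast; ring
  -- The trace identity `l1` distributes the centring constant among the factors.
  have e1 : (∫ z, Complex.exp (Complex.I * (∑ i, w i * (z i ^ 2 - C i i) : ℝ))
      ∂multivariateGaussian 0 C) =
      ∏ j, ∫ x, Complex.exp (Complex.I * (l j * (x ^ 2 - 1) : ℝ)) ∂gaussianReal 0 1 := by
    simp_rw [mul_sub, Finset.sum_sub_distrib, mul_one, hcentre, integral_mul_const]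
    rw [Finset.prod_mul_distrib, ← l4, ← Complex.exp_sum, Finset.sum_neg_distrib,
      ← Finset.mul_sum, ← l1, Complex.ofReal_sum]
  have e2 : Complex.exp ((-∑ i, ∑ j, w i * w j * C i j ^ 2 : ℝ) : ℂ) =
      ∏ j, Complex.exp ((-l j ^ 2 : ℝ) : ℂ) := by
    rw [← l2, ← Complex.exp_sum, ← Finset.sum_neg_distrib, Complex.ofReal_sum]
  rw [e1, e2, ← l2, Finset.mul_sum]
  refine (norm_prod_sub_prod_le_sum _ (fun j => ?_) (fun j => ?_)).trans
    (Finset.sum_le_sum fun j _ => hb _ ((l3 K m hK hm j).trans hmK))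
  · refine (norm_integral_le_integral_norm _).trans (le_of_eq ?_)
    simp_rw [mul_comm Complex.I, Complex.norm_exp_ofReal_mul_I]
    simp
  · rw [Complex.norm_exp_ofReal, Real.exp_le_one_iff]
    simp [sq_nonneg]

end GaussianQuadraticForm

/-! ### Increments of a Gaussian intrinsic random function -/

section Increments

open Matrix

/-- The total mass of a finitely supported signed measure. -/
noncomputable def mass : (Plane →₀ ℝ) →ₗ[ℝ] ℝ := Finsupp.linearCombination ℝ fun _ => 1

lemma mass_eq (c : Plane →₀ ℝ) : mass c = c.sum fun _ a => a := by
  simp [mass, Finsupp.linearCombination_apply]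

/-- The bilinear form `∑ₓ ∑ᵧ c(x) d(y) K(x - y)`. -/
noncomputable def covForm (K : Plane → ℝ) : (Plane →₀ ℝ) →ₗ[ℝ] (Plane →₀ ℝ) →ₗ[ℝ] ℝ :=
  Finsupp.linearCombination ℝ fun x => Finsupp.linearCombination ℝ fun y => K (x - y)

lemma covForm_eq (K : Plane → ℝ) (c d : Plane →₀ ℝ) :
    covForm K c d = c.sum fun x a => d.sum fun y b => a * b * K (x - y) := by
  simp [covForm, Finsupp.linearCombination_apply, Finsupp.sum, Finset.mul_sum, mul_assoc]

lemma covForm_comm {K : Plane → ℝ} (hK : ∀ h, K (-h) = K h) (c d : Plane →₀ ℝ) :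
    covForm K c d = covForm K d c := by
  rw [covForm_eq, covForm_eq, Finsupp.sum_comm]
  refine Finsupp.sum_congr fun x _ => Finsupp.sum_congr fun y _ => ?_
  rw [← hK, neg_sub]; ring

variable {Ω : Type*} [MeasurableSpace Ω] {P : Measure Ω} {X : Plane → Ω → ℝ} {K : Plane → ℝ}

/-- The functional `∑ₓ c(x) X(x)`. -/
noncomputable def increment (X : Plane → Ω → ℝ) (c : Plane →₀ ℝ) (ω : Ω) : ℝ :=
  Finsupp.linearCombination ℝ (fun x => X x ω) c

lemma IsGaussianIRF0.hasGaussianLaw (hX : IsGaussianIRF0 P X K) {c : Plane →₀ ℝ}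
    (hc : mass c = 0) : HasGaussianLaw (increment X c) P :=
  hX.gaussian c (mass_eq c ▸ hc)

lemma IsGaussianIRF0.integral_increment (hX : IsGaussianIRF0 P X K) {c : Plane →₀ ℝ}
    (hc : mass c = 0) : ∫ ω, increment X c ω ∂P = 0 :=
  hX.mean c (mass_eq c ▸ hc)

lemma IsGaussianIRF0.variance_increment (hX : IsGaussianIRF0 P X K) {c : Plane →₀ ℝ}
    (hc : mass c = 0) : Var[increment X c; P] = covForm K c c := by
  rw [covForm_eq]
  exact hX.variance c (mass_eq c ▸ hc)

lemma IsGaussianIRF0.integral_increment_sq (hX : IsGaussianIRF0 P X K) {c : Plane →₀ ℝ}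
    (hc : mass c = 0) : ∫ ω, increment X c ω ^ 2 ∂P = covForm K c c := by
  rw [← hX.variance_increment hc, variance_of_integral_eq_zero
    (hX.hasGaussianLaw hc).aemeasurable (hX.integral_increment hc)]

variable {ι : Type*} [Fintype ι]

/-- The covariance matrix of a finite family of increments. -/
noncomputable def covMatrix (K : Plane → ℝ) (c : ι → Plane →₀ ℝ) : Matrix ι ι ℝ :=
  fun i j => covForm K (c i) (c j)

/-- Bilinearity reduces a statement about a covariance matrix to the variance of one increment.
Positivity and the uniform operator bound both rest on this. -/
lemma dotProduct_covMatrix_mulVec (K : Plane → ℝ) (c : ι → Plane →₀ ℝ) (v : ι → ℝ) :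
    v ⬝ᵥ covMatrix K c *ᵥ v = covForm K (∑ i, v i • c i) (∑ i, v i • c i) := by
  simp only [dotProduct, mulVec, covMatrix, map_sum, LinearMap.sum_apply, Finset.mul_sum, map_smul,
    LinearMap.smul_apply, smul_eq_mul]
  rw [Finset.sum_comm]
  exact Finset.sum_congr rfl fun i _ => Finset.sum_congr rfl fun j _ => by ring

lemma IsGaussianIRF0.posSemidef_covMatrix (hX : IsGaussianIRF0 P X K) (hK : ∀ h, K (-h) = K h)
    {c : ι → Plane →₀ ℝ} (hc : ∀ i, mass (c i) = 0) : (covMatrix K c).PosSemidef := by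
  refine PosSemidef.of_dotProduct_mulVec_nonneg ?_ fun v => ?_
  · ext i j
    exact covForm_comm hK _ _
  · rw [star_trivial, dotProduct_covMatrix_mulVec,
      ← hX.variance_increment (by simp [map_sum, hc])]
    exact variance_nonneg _ _

/-- A finite family of increments is a centred Gaussian vector. -/
lemma IsGaussianIRF0.map_increments [DecidableEq ι] [IsProbabilityMeasure P]
    (hX : IsGaussianIRF0 P X K) (hK : ∀ h, K (-h) = K h)
    {c : ι → Plane →₀ ℝ} (hc : ∀ i, mass (c i) = 0) :
    P.map (fun ω => WithLp.toLp 2 fun i => increment X (c i) ω) =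
      multivariateGaussian 0 (covMatrix K c) := by
  have hm : AEMeasurable (fun ω => WithLp.toLp 2 fun i => increment X (c i) ω) P :=
    (PiLp.continuous_toLp 2 _).measurable.comp_aemeasurable
      (aemeasurable_pi_lambda _ fun i => (hX.hasGaussianLaw (hc i)).aemeasurable)
  have := Measure.isProbabilityMeasure_map hm
  refine Measure.ext_of_charFun (funext fun v => ?_)
  -- Cramér–Wold: the characteristic function of the vector at `v` is that of the single increment
  -- `∑ i, v i • c i` at `1`.
  have hv : mass (∑ i, v i • c i) = 0 := by simp [map_sum, hc]
  have h1 := (hX.hasGaussianLaw hv).charFun_map_eq 1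
  simp only [RCLike.inner_apply, map_one, mul_one] at h1
  have h2 := hX.integral_increment hv
  have h3 := hX.variance_increment hv
  rw [charFun_multivariateGaussian (hX.posSemidef_covMatrix hK hc), dotProduct_covMatrix_mulVec]
  rw [h2, h3, charFun_apply_real, integral_map (hX.hasGaussianLaw hv).aemeasurable
    (by fun_prop)] at h1
  rw [charFun_apply, integral_map hm (by fun_prop), inner_zero_right, ← h1]
  congr 1
  ext ω
  simp [PiLp.inner_apply, increment, map_sum]

end Increments

/-! ### Spectral representation of the power law -/

section SpectralRepresentation

open Set

variable {φ : ℝ}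

lemma abs_one_sub_exp_neg_le {x : ℝ} (hx : 0 ≤ x) : |1 - Real.exp (-x)| ≤ x := by
  rw [abs_of_nonneg (by simpa using hx)]
  linarith [Real.add_one_le_exp (-x)]

lemma abs_one_sub_exp_neg_le_one {x : ℝ} (hx : 0 ≤ x) : |1 - Real.exp (-x)| ≤ 1 := by
  rw [abs_of_nonneg (by simpa using hx)]
  linarith [Real.exp_pos (-x)]

/-- The integrand is at most `a * y ^ (-φ)` near `0`, integrable as `φ < 1`, and at most `y ^ (-φ -
1)` at infinity, integrable as `φ > 0`. -/
lemma integrableOn_rpow_mul_one_sub_exp (h0 : 0 < φ) (h1 : φ < 1) {a : ℝ} (ha : 0 ≤ a) :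
    IntegrableOn (fun y : ℝ => y ^ (-φ - 1) * (1 - Real.exp (-(a * y)))) (Ioi 0) := by
  have hm : AEStronglyMeasurable (fun y : ℝ => y ^ (-φ - 1) * (1 - Real.exp (-(a * y)))) :=
    (by fun_prop : Measurable _).aestronglyMeasurable
  rw [← Ioc_union_Ioi_eq_Ioi zero_le_one]
  refine IntegrableOn.union ?_ ?_
  · have h : IntegrableOn (fun y : ℝ => a * y ^ (-φ)) (Ioc 0 1) :=
      ((intervalIntegral.intervalIntegrable_rpow' (by linarith : -1 < -φ)).1).const_mul a
    refine h.mono' hm.restrict ((ae_restrict_iff' measurableSet_Ioc).2 (ae_of_all _ ?_))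
    rintro y ⟨hy, -⟩
    rw [norm_mul, Real.norm_eq_abs, Real.norm_eq_abs, abs_of_pos (Real.rpow_pos_of_pos hy _)]
    calc y ^ (-φ - 1) * |1 - Real.exp (-(a * y))| ≤ y ^ (-φ - 1) * (a * y) := by
          gcongr; exact abs_one_sub_exp_neg_le (by positivity)
      _ = a * (y ^ (-φ - 1) * y ^ (1 : ℝ)) := by rw [Real.rpow_one]; ring
      _ = a * y ^ (-φ) := by rw [← Real.rpow_add hy]; ring_nf
  · have h : IntegrableOn (fun y : ℝ => y ^ (-φ - 1)) (Ioi 1) :=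
      integrableOn_Ioi_rpow_of_lt (by linarith) zero_lt_one
    refine h.mono' hm.restrict ((ae_restrict_iff' measurableSet_Ioi).2 (ae_of_all _ ?_))
    intro y hy
    have hy : (0 : ℝ) < y := zero_lt_one.trans hy
    rw [norm_mul, Real.norm_eq_abs, Real.norm_eq_abs, abs_of_pos (Real.rpow_pos_of_pos hy _)]
    exact mul_le_of_le_one_right (by positivity) (abs_one_sub_exp_neg_le_one (by positivity))

/-- Integration by parts against the primitive `-y ^ (-φ) / φ` leaves a Gamma integral, and `Γ(1 -
φ) = -φ Γ(-φ)`. The boundary terms vanish at both ends. -/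
lemma integral_rpow_mul_one_sub_exp (h0 : 0 < φ) (h1 : φ < 1) {a : ℝ} (ha : 0 ≤ a) :
    ∫ y in Ioi 0, y ^ (-φ - 1) * (1 - Real.exp (-(a * y))) = -Real.Gamma (-φ) * a ^ φ := by
  rcases ha.eq_or_lt with rfl | ha
  · simp [Real.zero_rpow h0.ne']
  have hint := integrableOn_rpow_mul_one_sub_exp h0 h1 ha.le
  have hg : IntegrableOn (fun y : ℝ => y ^ (-φ) * Real.exp (-(a * y))) (Ioi 0) := by
    have := integrableOn_rpow_mul_exp_neg_mul_rpow (p := 1) (s := -φ) (by linarith) one_pos ha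
    simpa using this
  have hgv := Real.integral_rpow_mul_exp_neg_mul_Ioi (a := 1 - φ) (by linarith) ha
  rw [show 1 - φ - 1 = -φ by ring] at hgv
  have hu : ∀ y ∈ Ioi (0 : ℝ), HasDerivAt (fun y : ℝ => -(y ^ (-φ)) / φ) (y ^ (-φ - 1)) y := by
    intro y hy
    have h := (Real.hasDerivAt_rpow_const (p := -φ) (Or.inl (ne_of_gt hy))).neg.div_const φ
    have e : -(-φ * y ^ (-φ - 1)) / φ = y ^ (-φ - 1) := by have := h0.ne'; field_simp
    rw [e] at h
    exact h
  have hv : ∀ y ∈ Ioi (0 : ℝ), HasDerivAt (fun y : ℝ => 1 - Real.exp (-(a * y)))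
      (a * Real.exp (-(a * y))) y := by
    intro y _
    have h := (((hasDerivAt_id y).const_mul a).neg.exp).const_sub 1
    have e : -(Real.exp (-(a * y)) * -(a * 1)) = a * Real.exp (-(a * y)) := by ring
    rw [← e]
    exact h
  have hsum : IntegrableOn (fun y : ℝ => y ^ (-φ - 1) * (1 - Real.exp (-(a * y))) +
      (-(y ^ (-φ)) / φ) * (a * Real.exp (-(a * y)))) (Ioi 0) := by
    refine hint.add ((hg.const_mul (-(a / φ))).congr (ae_of_all _ fun y => ?_))
    simp only; ring
  have bound : ∀ y ∈ Ioi (0 : ℝ), ‖-(y ^ (-φ)) / φ * (1 - Real.exp (-(a * y)))‖ ≤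
      y ^ (-φ) / φ * |1 - Real.exp (-(a * y))| := by
    intro y hy
    rw [norm_mul, norm_div, norm_neg, Real.norm_of_nonneg (Real.rpow_nonneg (le_of_lt hy) _),
      Real.norm_of_nonneg h0.le, Real.norm_eq_abs]
  have hz : Tendsto (fun y : ℝ => -(y ^ (-φ)) / φ * (1 - Real.exp (-(a * y)))) (𝓝[>] 0) (𝓝 0) := by
    have hlim : Tendsto (fun y : ℝ => a / φ * y ^ (1 - φ)) (𝓝[>] 0) (𝓝 0) := by
      have : Tendsto (fun y : ℝ => a / φ * y ^ (1 - φ)) (𝓝 0) (𝓝 (a / φ * 0 ^ (1 - φ))) :=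
        ((Real.continuousAt_rpow_const 0 (1 - φ) (Or.inr (by linarith))).tendsto).const_mul _
      rw [Real.zero_rpow (by linarith), mul_zero] at this
      exact this.mono_left nhdsWithin_le_nhds
    refine squeeze_zero_norm' ?_ hlim
    filter_upwards [self_mem_nhdsWithin] with y hy
    have hy' : (0 : ℝ) < y := hy
    refine (bound y hy).trans ?_
    calc y ^ (-φ) / φ * |1 - Real.exp (-(a * y))| ≤ y ^ (-φ) / φ * (a * y) := by
          gcongr; exact abs_one_sub_exp_neg_le (by positivity)
      _ = a / φ * (y ^ (-φ) * y ^ (1 : ℝ)) := by rw [Real.rpow_one]; ring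
      _ = a / φ * y ^ (1 - φ) := by rw [← Real.rpow_add hy']; ring_nf
  have hinf : Tendsto (fun y : ℝ => -(y ^ (-φ)) / φ * (1 - Real.exp (-(a * y)))) atTop (𝓝 0) := by
    have hlim : Tendsto (fun y : ℝ => y ^ (-φ) / φ) atTop (𝓝 0) := by
      simpa using (tendsto_rpow_neg_atTop h0).div_const φ
    refine squeeze_zero_norm' ?_ hlim
    filter_upwards [eventually_gt_atTop 0] with y hy
    exact (bound y hy).trans (mul_le_of_le_one_right (by positivity)
      (abs_one_sub_exp_neg_le_one (by positivity)))
  have key := integral_Ioi_deriv_mul_eq_sub hu hv hsum hz hinf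
  have e2 : ∫ y in Ioi (0 : ℝ), (-(y ^ (-φ)) / φ) * (a * Real.exp (-(a * y))) =
      -(a / φ) * ((1 / a) ^ (1 - φ) * Real.Gamma (1 - φ)) := by
    rw [← hgv, ← integral_const_mul]
    congr 1; ext y; ring
  have i2 : IntegrableOn (fun y : ℝ => (-(y ^ (-φ)) / φ) * (a * Real.exp (-(a * y)))) (Ioi 0) :=
    (hg.const_mul (-(a / φ))).congr (ae_of_all _ fun y => by simp only; ring)
  rw [integral_add hint i2, e2, sub_zero] at key
  have hG : Real.Gamma (1 - φ) = -φ * Real.Gamma (-φ) := by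
    rw [← Real.Gamma_add_one (by linarith : -φ ≠ 0)]; ring_nf
  rw [hG, one_div, Real.inv_rpow ha.le, ← Real.rpow_neg ha.le, neg_sub,
    Real.rpow_sub_one ha.ne'] at key
  have := h0.ne'
  field_simp at key
  linarith

/-- The substitution `y = 1 / t` gives the form in which the integral over Gaussian scales appears.
-/
lemma integral_rpow_mul_one_sub_exp_inv (h0 : 0 < φ) (h1 : φ < 1) {a : ℝ} (ha : 0 ≤ a) :
    IntegrableOn (fun t : ℝ => t ^ (φ - 1) * (1 - Real.exp (-(a / t)))) (Ioi 0) ∧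
    ∫ t in Ioi 0, t ^ (φ - 1) * (1 - Real.exp (-(a / t))) = -Real.Gamma (-φ) * a ^ φ := by
  have e : EqOn (fun x : ℝ => (|(-1 : ℝ)| * x ^ ((-1 : ℝ) - 1)) •
      ((x ^ (-1 : ℝ)) ^ (-φ - 1) * (1 - Real.exp (-(a * x ^ (-1 : ℝ))))))
      (fun t : ℝ => t ^ (φ - 1) * (1 - Real.exp (-(a / t)))) (Ioi 0) := by
    intro t ht
    have ht : (0 : ℝ) < t := ht
    simp only [abs_neg, abs_one, one_mul, smul_eq_mul, ← mul_assoc]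
    rw [← Real.rpow_mul ht.le, ← Real.rpow_add ht, Real.rpow_neg_one, div_eq_mul_inv]
    ring_nf
  refine ⟨?_, ?_⟩
  · have := (integrableOn_Ioi_comp_rpow_iff
      (fun y : ℝ => y ^ (-φ - 1) * (1 - Real.exp (-(a * y)))) (p := -1) (by norm_num)).2
      (integrableOn_rpow_mul_one_sub_exp h0 h1 ha)
    exact this.congr_fun e measurableSet_Ioi
  · rw [← integral_rpow_mul_one_sub_exp h0 h1 ha, ← integral_comp_rpow_Ioi
      (fun y : ℝ => y ^ (-φ - 1) * (1 - Real.exp (-(a * y)))) (p := -1) (by norm_num)]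
    exact (setIntegral_congr_fun measurableSet_Ioi e).symm

/-- The Gaussian regularization of `∫ (1 - cos ⟨x, v⟩) dv`. -/
lemma integral_one_sub_cos_mul_exp {t : ℝ} (ht : 0 < t) (x : Plane) :
    Integrable (fun v : Plane => (1 - Real.cos (inner ℝ x v)) * Real.exp (-(t * ‖v‖ ^ 2))) ∧
    ∫ v : Plane, (1 - Real.cos (inner ℝ x v)) * Real.exp (-(t * ‖v‖ ^ 2)) =
      Real.pi / t * (1 - Real.exp (-(‖x‖ ^ 2 / 4 / t))) := by
  have ht' : 0 < (t : ℂ).re := by simpa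
  have i0 := GaussianFourier.integrable_cexp_neg_mul_sq_norm_add ht' 0 x
  have i1 := GaussianFourier.integrable_cexp_neg_mul_sq_norm_add ht' Complex.I x
  have v0 := GaussianFourier.integral_cexp_neg_mul_sq_norm_add ht' 0 x
  have v1 := GaussianFourier.integral_cexp_neg_mul_sq_norm_add ht' Complex.I x
  -- The integrand is the real part of a difference of Gaussian Fourier integrands, at frequencies
  -- `0` and `x`.
  have e : ∀ v : Plane, (1 - Real.cos (inner ℝ x v)) * Real.exp (-(t * ‖v‖ ^ 2)) =
      RCLike.re (Complex.exp (-t * ‖v‖ ^ 2 + 0 * (inner ℝ x v : ℝ))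
        - Complex.exp (-t * ‖v‖ ^ 2 + Complex.I * (inner ℝ x v : ℝ))) := by
    intro v
    have h1 : (-t * ‖v‖ ^ 2 + 0 * (inner ℝ x v : ℝ) : ℂ) = ((-(t * ‖v‖ ^ 2) : ℝ) : ℂ) := by
      push_cast; ring
    have h2 : (-t * ‖v‖ ^ 2 + Complex.I * (inner ℝ x v : ℝ) : ℂ) =
      ((-(t * ‖v‖ ^ 2) : ℝ) : ℂ) + (inner ℝ x v : ℝ) * Complex.I := by push_cast; ring
    rw [h1, h2, Complex.exp_add, ← Complex.ofReal_exp]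
    simp only [RCLike.re_to_complex, Complex.sub_re, Complex.ofReal_re, Complex.re_ofReal_mul,
      Complex.exp_ofReal_mul_I_re]
    ring
  simp_rw [e]
  refine ⟨(i0.sub i1).re, ?_⟩
  refine (integral_re (i0.sub i1)).trans ?_
  rw [integral_sub' i0 i1, v0, v1]
  have h3 : (Complex.I ^ 2 * (‖x‖ : ℂ) ^ 2 / (4 * t)) = ((-(‖x‖ ^ 2 / 4 / t) : ℝ) : ℂ) := by
    rw [Complex.I_sq]; push_cast; field_simp
  -- In dimension two the exponent `dim / 2` of `π / t` is `1`.
  have h4 : ((Module.finrank ℝ Plane : ℂ) / 2) = 1 := by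
    simp
  rw [h3, h4, Complex.cpow_one]
  refine (congrArg RCLike.re (?_ : _ = ((Real.pi / t * (1 - Real.exp (-(‖x‖ ^ 2 / 4 / t))) : ℝ)
    : ℂ))).trans (Complex.ofReal_re _)
  push_cast
  rw [zero_pow two_ne_zero, zero_mul, zero_div, Complex.exp_zero]
  ring

/-- The Fourier representation of `‖x‖ ^ (2φ)`. -/
lemma lintegral_one_sub_cos_mul_rpow (h0 : 0 < φ) (h1 : φ < 1) (x : Plane) :
    ∫⁻ v : Plane, ENNReal.ofReal ((1 - Real.cos (inner ℝ x v)) * ‖v‖ ^ (-(2 + 2 * φ))) =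
      ENNReal.ofReal (Real.pi / Real.Gamma (1 + φ) *
        (-Real.Gamma (-φ) * (‖x‖ ^ 2 / 4) ^ φ)) := by
  have hG : 0 < Real.Gamma (1 + φ) := Real.Gamma_pos_of_pos (by linarith)
  have hcos : ∀ v : Plane, 0 ≤ 1 - Real.cos (inner ℝ x v) := fun v => by
    linarith [Real.cos_le_one (inner ℝ x v)]
  have hexp : ∀ t : ℝ, 0 < t → 0 ≤ 1 - Real.exp (-(‖x‖ ^ 2 / 4 / t)) := fun t ht => by
    have : (0 : ℝ) ≤ ‖x‖ ^ 2 / 4 / t := by positivity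
    simpa using this
  have hne : ∀ᵐ v : Plane, v ≠ 0 := by
    simp [ae_iff, measure_singleton]
  -- The Gamma integral writes `‖v‖ ^ (-(2 + 2φ))` as a mixture of the Gaussians `exp (-t‖v‖²)`. All
  -- terms are nonnegative, so Tonelli allows the exchange below and finiteness of the result will
  -- yield integrability.
  have e1 : ∀ᵐ v : Plane, ENNReal.ofReal ((1 - Real.cos (inner ℝ x v)) * ‖v‖ ^ (-(2 + 2 * φ))) =
      ∫⁻ t in Ioi (0 : ℝ), ENNReal.ofReal (1 / Real.Gamma (1 + φ) * (t ^ φ *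
        ((1 - Real.cos (inner ℝ x v)) * Real.exp (-(t * ‖v‖ ^ 2))))) := by
    filter_upwards [hne] with v hv
    have hr : 0 < ‖v‖ ^ 2 := by positivity
    have := Real.integral_rpow_mul_exp_neg_mul_Ioi (a := 1 + φ) (by linarith) hr
    rw [add_sub_cancel_left] at this
    have hi : IntegrableOn (fun t : ℝ => t ^ φ * Real.exp (-(‖v‖ ^ 2 * t))) (Ioi 0) := by
      have := integrableOn_rpow_mul_exp_neg_mul_rpow (p := 1) (s := φ) (by linarith) one_pos hr
      simpa using this
    rw [← ofReal_integral_eq_lintegral_ofReal]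
    · congr 1
      have : ∀ t : ℝ, 1 / Real.Gamma (1 + φ) * (t ^ φ * ((1 - Real.cos (inner ℝ x v)) *
          Real.exp (-(t * ‖v‖ ^ 2)))) = (1 - Real.cos (inner ℝ x v)) / Real.Gamma (1 + φ) *
          (t ^ φ * Real.exp (-(‖v‖ ^ 2 * t))) := fun t => by rw [mul_comm t]; ring
      simp_rw [this]
      rw [integral_const_mul, ‹∫ t in Ioi (0 : ℝ), _ = _›, one_div, Real.inv_rpow hr.le,
        ← Real.rpow_neg hr.le, ← Real.rpow_natCast, ← Real.rpow_mul (norm_nonneg _)]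
      push_cast
      rw [show (2 : ℝ) * -(1 + φ) = -(2 + 2 * φ) by ring]
      field_simp
    · refine (hi.const_mul ((1 - Real.cos (inner ℝ x v)) / Real.Gamma (1 + φ))).congr
        (ae_of_all _ fun t => ?_)
      simp only; rw [mul_comm t]; ring
    · refine (ae_restrict_iff' measurableSet_Ioi).2 (ae_of_all _ fun t ht => ?_)
      have := hcos v
      have ht : (0 : ℝ) < t := ht
      positivity
  rw [lintegral_congr_ae e1, lintegral_lintegral_swap (by fun_prop)]
  have e2 : ∀ t ∈ Ioi (0 : ℝ), ∫⁻ v : Plane, ENNReal.ofReal (1 / Real.Gamma (1 + φ) * (t ^ φ *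
        ((1 - Real.cos (inner ℝ x v)) * Real.exp (-(t * ‖v‖ ^ 2))))) =
      ENNReal.ofReal (Real.pi / Real.Gamma (1 + φ) *
        (t ^ (φ - 1) * (1 - Real.exp (-(‖x‖ ^ 2 / 4 / t))))) := by
    intro t ht
    have ht : (0 : ℝ) < t := ht
    obtain ⟨hi, hv⟩ := integral_one_sub_cos_mul_exp ht x
    rw [← ofReal_integral_eq_lintegral_ofReal ((hi.const_mul _).const_mul _)
      (ae_of_all _ fun v => by have := hcos v; positivity), integral_const_mul, integral_const_mul,
      hv, Real.rpow_sub_one ht.ne']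
    congr 1; ring
  rw [setLIntegral_congr_fun measurableSet_Ioi e2]
  obtain ⟨hi, hv⟩ := integral_rpow_mul_one_sub_exp_inv h0 h1 (a := ‖x‖ ^ 2 / 4) (by positivity)
  rw [← ofReal_integral_eq_lintegral_ofReal (hi.const_mul _), integral_const_mul, hv]
  refine (ae_restrict_iff' measurableSet_Ioi).2 (ae_of_all _ fun t ht => ?_)
  have ht' : (0 : ℝ) < t := ht
  have := hexp t ht
  positivity

variable {φ₁ φ₂ : ℝ}

/-- The power law is the Fourier transform of its spectral density. -/
lemma integral_one_sub_cos_mul_planeDensity (hφ₁ : 0 < φ₁) (h0 : 0 < φ₂) (h1 : φ₂ < 1)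
    (x : Plane) :
    Integrable (fun v : Plane => (1 - Real.cos (inner ℝ x v)) * planeDensity φ₁ φ₂ v)
      specMeasure ∧
    ∫ v : Plane, (1 - Real.cos (inner ℝ x v)) * planeDensity φ₁ φ₂ v ∂specMeasure =
      -genCov φ₁ φ₂ x := by
  have hG : 0 < Real.Gamma (1 + φ₂) := Real.Gamma_pos_of_pos (by linarith)
  have hnn : ∀ v : Plane, 0 ≤ (1 - Real.cos (inner ℝ x v)) * ‖v‖ ^ (-(2 + 2 * φ₂)) := fun v =>
    mul_nonneg (by linarith [Real.cos_le_one (inner ℝ x v)]) (by positivity)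
  have hl := lintegral_one_sub_cos_mul_rpow h0 h1 x
  have hm : Measurable fun v : Plane => (1 - Real.cos (inner ℝ x v)) * ‖v‖ ^ (-(2 + 2 * φ₂)) := by
    fun_prop
  have hi : Integrable fun v : Plane =>
      (1 - Real.cos (inner ℝ x v)) * ‖v‖ ^ (-(2 + 2 * φ₂)) := by
    rw [← lintegral_ofReal_ne_top_iff_integrable hm.aestronglyMeasurable (ae_of_all _ hnn), hl]
    exact ENNReal.ofReal_ne_top
  -- `Γ` is negative on `(-1, 0)`, since `Γ(1 - φ₂) = -φ₂ Γ(-φ₂)` is positive.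
  have hneg : 0 ≤ -Real.Gamma (-φ₂) := by
    have := Real.Gamma_add_one (by linarith : -φ₂ ≠ 0)
    have h2 : 0 < Real.Gamma (-φ₂ + 1) := Real.Gamma_pos_of_pos (by linarith)
    nlinarith
  have e : ∀ v : Plane, (1 - Real.cos (inner ℝ x v)) * planeDensity φ₁ φ₂ v =
      (2 ^ (2 * φ₂ + 2) * Real.pi * Real.Gamma (1 + φ₂) * φ₁) *
        ((1 - Real.cos (inner ℝ x v)) * ‖v‖ ^ (-(2 + 2 * φ₂))) := fun v => by
    rw [planeDensity]; ring
  simp_rw [e]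
  refine ⟨(hi.const_mul _).smul_measure ENNReal.ofReal_ne_top, ?_⟩
  rw [specMeasure, integral_smul_measure, integral_const_mul,
    integral_eq_lintegral_of_nonneg_ae (ae_of_all _ hnn) hm.aestronglyMeasurable, hl,
    ENNReal.toReal_ofReal (by positivity), ENNReal.toReal_ofReal (by positivity), genCov,
    Real.div_rpow (by positivity) (by norm_num), ← Real.rpow_natCast ‖x‖ 2,
    ← Real.rpow_mul (norm_nonneg _), Real.rpow_add two_pos, Real.rpow_mul zero_le_two]
  -- The constant of `planeDensity` is fixed here: `2 ^ (2φ₂ + 2) = 4 * 4 ^ φ₂` cancels the `4 ^ φ₂`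
  -- of `(‖x‖² / 4) ^ φ₂` and the `4` of `(2π)²`.
  have h4 : ((2 : ℝ) ^ (2 : ℝ)) = 4 := by norm_num
  have : (4 : ℝ) ^ φ₂ ≠ 0 := by positivity
  have hpi := Real.pi_ne_zero
  rw [h4, smul_eq_mul]
  push_cast
  field_simp
  ring

end SpectralRepresentation

/-! ### Spectral representation of increment covariances -/

section Transform

open ComplexConjugate

/-- The Fourier transform `∑ₓ c(x) exp (i⟨x, v⟩)` of a finitely supported signed measure. -/
noncomputable def transform (v : Plane) : (Plane →₀ ℝ) →ₗ[ℝ] ℂ :=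
  Finsupp.linearCombination ℝ fun x => Complex.exp (Complex.I * (inner ℝ x v : ℝ))

lemma continuous_transform (c : Plane →₀ ℝ) : Continuous fun v => transform v c := by
  simp only [transform, Finsupp.linearCombination_apply, Finsupp.sum]
  fun_prop

lemma measurable_planeDensity (φ₁ φ₂ : ℝ) : Measurable (planeDensity φ₁ φ₂) := by
  unfold planeDensity
  fun_prop

lemma planeDensity_neg (φ₁ φ₂ : ℝ) (v : Plane) : planeDensity φ₁ φ₂ (-v) = planeDensity φ₁ φ₂ v := by
  simp [planeDensity]

lemma planeDensity_nonneg {φ₁ φ₂ : ℝ} (hφ₁ : 0 < φ₁) (h0 : 0 < φ₂) (v : Plane) :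
    0 ≤ planeDensity φ₁ φ₂ v := by
  have : 0 < Real.Gamma (1 + φ₂) := Real.Gamma_pos_of_pos (by linarith)
  unfold planeDensity
  positivity

instance : specMeasure.IsAddHaarMeasure :=
  Measure.IsAddHaarMeasure.smul _
    (by simp only [ne_eq, ENNReal.ofReal_eq_zero, not_le]; positivity) ENNReal.ofReal_ne_top

instance : specMeasure.IsNegInvariant where
  neg_eq_self := by
    rw [specMeasure, Measure.neg_def, Measure.map_smul]
    exact congrArg _ (Measure.IsNegInvariant.neg_eq_self (μ := (volume : Measure Plane)))

/-- Because `c` has mass zero the constant term drops out, so `cos` may be replaced by `cos - 1`,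
which makes the integral against `planeDensity` converge at the origin. -/
lemma re_transform_mul_conj {c d : Plane →₀ ℝ} (hc : mass c = 0) (v : Plane) :
    (transform v c * conj (transform v d)).re =
      -c.sum fun x a => d.sum fun y b => a * b * (1 - Real.cos (inner ℝ (x - y) v)) := by
  have h1 : (transform v c * conj (transform v d)).re =
      c.sum fun x a => d.sum fun y b => a * b * Real.cos (inner ℝ (x - y) v) := by
    simp only [transform, Finsupp.linearCombination_apply, Finsupp.sum, map_sum,
      Finset.sum_mul_sum, Complex.re_sum, Complex.real_smul, map_mul, Complex.conj_ofReal,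
      ← Complex.exp_conj, Complex.conj_I]
    refine Finset.sum_congr rfl fun x _ => Finset.sum_congr rfl fun y _ => ?_
    rw [mul_mul_mul_comm, ← Complex.exp_add, ← Complex.ofReal_mul, Complex.re_ofReal_mul,
      inner_sub_left, ← Complex.exp_ofReal_mul_I_re]
    congr 3
    push_cast; ring
  have h2 : (c.sum fun x a => d.sum fun y b => a * b) = 0 := by
    rw [mass_eq] at hc
    simp only [Finsupp.sum] at hc ⊢
    simp_rw [← Finset.mul_sum, ← Finset.sum_mul, hc, zero_mul]
  have h3 : ∀ x a y b, a * b * (1 - Real.cos (inner ℝ (x - y) v)) =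
      a * b - a * b * Real.cos (inner ℝ (x - y) v) := fun x a y b => by ring
  simp only [Finsupp.sum] at h1 h2 ⊢
  simp_rw [h3, Finset.sum_sub_distrib]
  rw [h2, h1]; ring

variable {φ₁ φ₂ : ℝ}

lemma integral_planeDensity_mul_re (hφ₁ : 0 < φ₁) (h0 : 0 < φ₂) (h1 : φ₂ < 1)
    {c d : Plane →₀ ℝ} (hc : mass c = 0) :
    Integrable (fun v => planeDensity φ₁ φ₂ v * (transform v c * conj (transform v d)).re)
      specMeasure ∧
    ∫ v, planeDensity φ₁ φ₂ v * (transform v c * conj (transform v d)).re ∂specMeasure =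
      covForm (genCov φ₁ φ₂) c d := by
  have e : (fun v => planeDensity φ₁ φ₂ v * (transform v c * conj (transform v d)).re) =
      fun v => ∑ x ∈ c.support, ∑ y ∈ d.support, -(c x * d y) *
        ((1 - Real.cos (inner ℝ (x - y) v)) * planeDensity φ₁ φ₂ v) := by
    ext v
    rw [re_transform_mul_conj hc]
    simp only [Finsupp.sum, Finset.mul_sum, ← Finset.sum_neg_distrib]
    exact Finset.sum_congr rfl fun x _ => Finset.sum_congr rfl fun y _ => by ring
  have hi := fun x => (integral_one_sub_cos_mul_planeDensity hφ₁ h0 h1 x).1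
  have hv := fun x => (integral_one_sub_cos_mul_planeDensity hφ₁ h0 h1 x).2
  rw [e]
  refine ⟨integrable_finsetSum _ fun x _ => integrable_finsetSum _ fun y _ =>
    (hi _).const_mul _, ?_⟩
  rw [integral_finsetSum _ fun x _ => integrable_finsetSum _ fun y _ => (hi _).const_mul _]
  simp_rw [integral_finsetSum _ fun y _ => (hi (_ - y)).const_mul _, integral_const_mul, hv]
  rw [covForm_eq]
  exact Finset.sum_congr rfl fun x _ => Finset.sum_congr rfl fun y _ => by ring

lemma transform_neg (v : Plane) (c : Plane →₀ ℝ) : transform (-v) c = conj (transform v c) := by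
  simp [transform, Finsupp.linearCombination_apply, Finsupp.sum, ← Complex.exp_conj]

lemma integrable_planeDensity_mul_norm_sq (hφ₁ : 0 < φ₁) (h0 : 0 < φ₂) (h1 : φ₂ < 1)
    {c : Plane →₀ ℝ} (hc : mass c = 0) :
    Integrable (fun v => planeDensity φ₁ φ₂ v * ‖transform v c‖ ^ 2) specMeasure := by
  refine (integral_planeDensity_mul_re hφ₁ h0 h1 (d := c) hc).1.congr (ae_of_all _ fun v => ?_)
  simp [Complex.mul_conj, Complex.normSq_eq_norm_sq, -Complex.ofReal_pow]

/-- **Spectral representation** of the covariances of increments. -/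
lemma integral_planeDensity_smul_transform (hφ₁ : 0 < φ₁) (h0 : 0 < φ₂) (h1 : φ₂ < 1)
    {c d : Plane →₀ ℝ} (hc : mass c = 0) (hd : mass d = 0) :
    Integrable (fun v => planeDensity φ₁ φ₂ v • (transform v c * conj (transform v d)))
      specMeasure ∧
    ∫ v, planeDensity φ₁ φ₂ v • (transform v c * conj (transform v d)) ∂specMeasure =
      (covForm (genCov φ₁ φ₂) c d : ℂ) := by
  set G : Plane → ℂ := fun v => planeDensity φ₁ φ₂ v • (transform v c * conj (transform v d))
  have hint : Integrable G specMeasure := by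
    refine ((integrable_planeDensity_mul_norm_sq hφ₁ h0 h1 hc).add
      (integrable_planeDensity_mul_norm_sq hφ₁ h0 h1 hd)).mono' ?_ (ae_of_all _ fun v => ?_)
    · have := continuous_transform c
      have := continuous_transform d
      exact ((measurable_planeDensity φ₁ φ₂).smul
        (by fun_prop : Continuous fun v => transform v c * conj (transform v d)).measurable
        ).aestronglyMeasurable
    · have := planeDensity_nonneg hφ₁ h0 v
      simp only [G, Pi.add_apply]
      rw [norm_smul, Real.norm_of_nonneg this, norm_mul, RCLike.norm_conj, ← mul_add]
      gcongr
      nlinarith [sq_nonneg (‖transform v c‖ - ‖transform v d‖), norm_nonneg (transform v c),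
        norm_nonneg (transform v d), mul_nonneg (norm_nonneg (transform v c))
        (norm_nonneg (transform v d))]
  refine ⟨hint, ?_⟩
  -- The reflection `v ↦ -v` preserves the measure and the density and conjugates the transforms, so
  -- the integral is real.
  have hreal : conj (∫ v, G v ∂specMeasure) = ∫ v, G v ∂specMeasure := by
    rw [← integral_conj, ← integral_neg_eq_self G]
    congr 1; ext v
    simp only [G, planeDensity_neg, transform_neg, Complex.real_smul, map_mul, Complex.conj_ofReal]
  obtain ⟨r, hr⟩ := Complex.conj_eq_iff_real.1 hreal
  have hre := integral_re hint
  rw [← (integral_planeDensity_mul_re hφ₁ h0 h1 hc).2, hr]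
  rw [hr] at hre
  congr 1
  refine Eq.trans (by simp) (hre.symm.trans ?_)
  congr 1; ext v
  simp only [G, RCLike.re_to_complex, Complex.smul_re, smul_eq_mul]

/-- The coefficients of the bilinear difference at step `r` and site `t`. -/
noncomputable def stencil (r : ℕ) (t : ℤ × ℤ) : Plane →₀ ℝ :=
  Finsupp.single (latticePoint t) 1 - Finsupp.single (latticePoint (t + ((r : ℤ), 0))) 1
    - Finsupp.single (latticePoint (t + (0, (r : ℤ)))) 1
    + Finsupp.single (latticePoint (t + ((r : ℤ), (r : ℤ)))) 1

lemma mass_stencil (r : ℕ) (t : ℤ × ℤ) : mass (stencil r t) = 0 := by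
  simp [mass, stencil]

lemma increment_stencil {Ω : Type*} (X : Plane → Ω → ℝ) (r : ℕ) (t : ℤ × ℤ) :
    increment X (stencil r t) = bilinDiff X r t := by
  ext ω
  simp [increment, stencil, bilinDiff]

lemma inner_latticePoint (t : ℤ × ℤ) (v : Plane) :
    inner ℝ (latticePoint t) v = t.1 * v 0 + t.2 * v 1 := by
  simp [latticePoint, PiLp.inner_apply, Fin.sum_univ_two, mul_comm]

/-- The character `exp (i⟨t, v⟩)`. -/
noncomputable def character (t : ℤ × ℤ) (v : Plane) : ℂ :=
  Complex.exp (Complex.I * (t.1 * v 0 + t.2 * v 1 : ℝ))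

lemma transform_stencil (r : ℕ) (t : ℤ × ℤ) (v : Plane) :
    transform v (stencil r t) = character t v * symbol r v := by
  simp only [transform, stencil, map_add, map_sub, Finsupp.linearCombination_single, one_smul,
    inner_latticePoint, character, symbol, mul_sub, sub_mul, mul_one, one_mul,
    ← Complex.exp_add]
  push_cast
  simp only [Prod.fst_add, Prod.snd_add]
  push_cast
  ring_nf

end Transform

/-! ### Aliasing: folding the plane onto the torus -/

section Periodization

lemma latticePoint_add (s t : ℤ × ℤ) : latticePoint (s + t) = latticePoint s + latticePoint t := by
  ext i; fin_cases i <;> simp [latticePoint]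

lemma latticePoint_zero : latticePoint 0 = 0 := by
  ext i; fin_cases i <;> simp [latticePoint]

/-- The period `2πm` of the lattice spectrum. -/
noncomputable def period (m : ℤ × ℤ) : Plane := (2 * Real.pi) • latticePoint m

lemma period_add (m k : ℤ × ℤ) : period (m + k) = period m + period k := by
  simp [period, latticePoint_add]

lemma period_zero : period 0 = 0 := by
  simp [period, latticePoint_zero]

lemma period_apply_zero (m : ℤ × ℤ) : period m 0 = 2 * Real.pi * m.1 := by
  simp [period, latticePoint]

lemma period_apply_one (m : ℤ × ℤ) : period m 1 = 2 * Real.pi * m.2 := by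
  simp [period, latticePoint]

lemma mem_torus {v : Plane} :
    v ∈ torus ↔ v 0 ∈ Set.Ioc (-Real.pi) Real.pi ∧ v 1 ∈ Set.Ioc (-Real.pi) Real.pi := by
  simp [torus, Fin.forall_fin_two]

lemma measurableSet_torus : MeasurableSet torus := by
  have : torus = ⋂ i : Fin 2, (fun v : Plane => v i) ⁻¹' Set.Ioc (-Real.pi) Real.pi := by
    ext v; simp [torus]
  rw [this]
  exact MeasurableSet.iInter fun i => (by fun_prop : Measurable fun v : Plane => v i)
    measurableSet_Ioc

/-- Translates of the torus tile the plane. -/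
lemma existsUnique_sub_period_mem_torus (v : Plane) : ∃! m : ℤ × ℤ, v - period m ∈ torus := by
  have h := fun x : ℝ => existsUnique_sub_zsmul_mem_Ioc Real.two_pi_pos x (-Real.pi)
  have e : -Real.pi + 2 * Real.pi = Real.pi := by ring
  simp only [e, zsmul_eq_mul] at h
  obtain ⟨a, ha, ha'⟩ := h (v 0)
  obtain ⟨b, hb, hb'⟩ := h (v 1)
  have key : ∀ m : ℤ × ℤ, v - period m ∈ torus ↔
      v 0 - m.1 * (2 * Real.pi) ∈ Set.Ioc (-Real.pi) Real.pi ∧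
      v 1 - m.2 * (2 * Real.pi) ∈ Set.Ioc (-Real.pi) Real.pi := fun m => by
    rw [mem_torus, PiLp.sub_apply, PiLp.sub_apply, period_apply_zero, period_apply_one,
      mul_comm (2 * Real.pi), mul_comm (2 * Real.pi)]
  refine ⟨(a, b), (key _).2 ⟨ha, hb⟩, fun m hm => ?_⟩
  exact Prod.ext (ha' _ ((key _).1 hm).1) (hb' _ ((key _).1 hm).2)

lemma norm_le_of_mem_torus {v : Plane} (hv : v ∈ torus) : ‖v‖ ≤ 2 * Real.pi := by
  rw [mem_torus] at hv
  have h0 : v 0 ^ 2 ≤ Real.pi ^ 2 := sq_le_sq' (by linarith [hv.1.1]) hv.1.2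
  have h1 : v 1 ^ 2 ≤ Real.pi ^ 2 := sq_le_sq' (by linarith [hv.2.1]) hv.2.2
  rw [EuclideanSpace.norm_eq, Fin.sum_univ_two]
  refine Real.sqrt_le_iff.2 ⟨by positivity, ?_⟩
  simp only [Real.norm_eq_abs, sq_abs]
  nlinarith [sq_nonneg Real.pi]

lemma specMeasure_torus_lt_top : specMeasure torus < ⊤ := by
  have : torus ⊆ Metric.closedBall (0 : Plane) (2 * Real.pi) := fun v hv =>
    mem_closedBall_zero_iff.2 (norm_le_of_mem_torus hv)
  exact (measure_mono this).trans_lt measure_closedBall_lt_top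

/-- For `k ≠ 0`, `|2πk| - |x| ≥ 2π|k| - π ≥ π|k|`. Applied to each coordinate, this gives the decay
of the aliasing terms. -/
lemma pi_mul_abs_le {x : ℝ} (hx : x ∈ Set.Ioc (-Real.pi) Real.pi) (k : ℤ) :
    Real.pi * |(k : ℝ)| ≤ |x + 2 * Real.pi * k| := by
  have hpi := Real.pi_pos
  have hx' : |x| ≤ Real.pi := abs_le.2 ⟨hx.1.le, hx.2⟩
  rcases eq_or_ne k 0 with rfl | hk
  · simp
  · have h1 : (1 : ℝ) ≤ |(k : ℝ)| := by exact_mod_cast Int.one_le_abs hk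
    have h2 : |2 * Real.pi * k| ≤ |x + 2 * Real.pi * k| + |x| := by
      calc |2 * Real.pi * k| = |(x + 2 * Real.pi * k) - x| := by ring_nf
        _ ≤ _ := abs_sub _ _
    rw [abs_mul, abs_of_pos Real.two_pi_pos] at h2
    nlinarith

lemma pi_mul_norm_le {v : Plane} (hv : v ∈ torus) (m : ℤ × ℤ) :
    Real.pi * ‖m‖ ≤ ‖v + period m‖ := by
  rw [mem_torus] at hv
  have h0 := (pi_mul_abs_le hv.1 m.1).trans
    (by simpa [period_apply_zero] using PiLp.norm_apply_le (v + period m) 0)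
  have h1 := (pi_mul_abs_le hv.2 m.2).trans
    (by simpa [period_apply_one] using PiLp.norm_apply_le (v + period m) 1)
  rw [Prod.norm_def, Int.norm_eq_abs, Int.norm_eq_abs, mul_max_of_nonneg _ _ Real.pi_pos.le]
  exact max_le h0 h1

/-- This is the convergence of Eisenstein series of exponent above `2`, the norm on `ℤ × ℤ` being
the sup norm. -/
lemma summable_norm_rpow_neg {s : ℝ} (hs : 2 < s) : Summable fun m : ℤ × ℤ => ‖m‖ ^ (-s) := by
  rw [← (finTwoArrowEquiv ℤ).summable_iff]
  refine (EisensteinSeries.summable_one_div_norm_rpow hs).congr fun x => ?_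
  simp [Function.comp, finTwoArrowEquiv, Prod.norm_def, EisensteinSeries.norm_eq_max_natAbs,
    Int.norm_eq_abs, Nat.cast_max]

variable {φ₁ φ₂ : ℝ}

/-- A summable majorant of the tail of the aliasing series over the torus. -/
noncomputable def aliasBound (φ₁ φ₂ : ℝ) (m : ℤ × ℤ) : ℝ :=
  2 ^ (2 * φ₂ + 2) * Real.pi * Real.Gamma (1 + φ₂) * φ₁ * Real.pi ^ (-(2 + 2 * φ₂)) *
    ‖m‖ ^ (-(2 + 2 * φ₂))

lemma summable_aliasBound (h0 : 0 < φ₂) : Summable (aliasBound φ₁ φ₂) :=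
  (summable_norm_rpow_neg (by linarith)).mul_left _

lemma aliasBound_nonneg (hφ₁ : 0 < φ₁) (h0 : 0 < φ₂) (m : ℤ × ℤ) : 0 ≤ aliasBound φ₁ φ₂ m := by
  have : 0 < Real.Gamma (1 + φ₂) := Real.Gamma_pos_of_pos (by linarith)
  unfold aliasBound
  positivity

lemma planeDensity_add_period_le (hφ₁ : 0 < φ₁) (h0 : 0 < φ₂) {v : Plane} (hv : v ∈ torus)
    {m : ℤ × ℤ} (hm : m ≠ 0) : planeDensity φ₁ φ₂ (v + period m) ≤ aliasBound φ₁ φ₂ m := by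
  have : 0 < Real.Gamma (1 + φ₂) := Real.Gamma_pos_of_pos (by linarith)
  have hm' : 0 < ‖m‖ := norm_pos_iff.2 hm
  rw [planeDensity, aliasBound, mul_assoc _ (Real.pi ^ _),
    ← Real.mul_rpow Real.pi_pos.le (norm_nonneg _)]
  gcongr ?_ * ?_
  exact Real.rpow_le_rpow_of_nonpos (by positivity) (pi_mul_norm_le hv m) (by linarith)

/-- The term `m = 0` is singular at the origin and has no uniform bound, so it is kept apart from
the majorant. -/
lemma planeDensity_add_period_le' (hφ₁ : 0 < φ₁) (h0 : 0 < φ₂) {v : Plane} (hv : v ∈ torus)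
    (m : ℤ × ℤ) : planeDensity φ₁ φ₂ (v + period m) ≤
      (if m = 0 then planeDensity φ₁ φ₂ v else 0) + aliasBound φ₁ φ₂ m := by
  split_ifs with hm
  · have := aliasBound_nonneg hφ₁ h0 m
    rw [hm] at this ⊢
    simpa [period_zero] using this
  · simpa using planeDensity_add_period_le hφ₁ h0 hv hm

lemma summable_planeDensity (hφ₁ : 0 < φ₁) (h0 : 0 < φ₂) (v : Plane) :
    Summable fun m : ℤ × ℤ => planeDensity φ₁ φ₂ (v + period m) := by
  obtain ⟨k, hk, -⟩ := existsUnique_sub_period_mem_torus v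
  have hs : Summable fun m : ℤ × ℤ => planeDensity φ₁ φ₂ (v - period k + period m) :=
    Summable.of_nonneg_of_le (fun m => planeDensity_nonneg hφ₁ h0 _)
      (planeDensity_add_period_le' hφ₁ h0 hk)
      ((hasSum_ite_eq (0 : ℤ × ℤ) _).summable.add (summable_aliasBound h0))
  -- A general point differs from its representative in the torus by a period, which only reindexes
  -- the series.
  refine ((Equiv.addRight k).summable_iff.2 hs).congr fun m => ?_
  simp only [Function.comp, Equiv.coe_addRight, period_add]
  congr 1; abel

lemma latticeDensity_eq (φ₁ φ₂ : ℝ) (v : Plane) :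
    latticeDensity φ₁ φ₂ v = ∑' m : ℤ × ℤ, planeDensity φ₁ φ₂ (v + period m) := rfl

lemma latticeDensity_nonneg (hφ₁ : 0 < φ₁) (h0 : 0 < φ₂) (v : Plane) :
    0 ≤ latticeDensity φ₁ φ₂ v :=
  tsum_nonneg fun _ => planeDensity_nonneg hφ₁ h0 _

lemma measurable_latticeDensity (hφ₁ : 0 < φ₁) (h0 : 0 < φ₂) :
    Measurable (latticeDensity φ₁ φ₂) := by
  -- In `ENNReal` a countable sum of measurable functions is measurable with no condition of
  -- convergence.
  have e : latticeDensity φ₁ φ₂ = fun v =>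
      (∑' m : ℤ × ℤ, ENNReal.ofReal (planeDensity φ₁ φ₂ (v + period m))).toReal := by
    ext v
    rw [← ENNReal.ofReal_tsum_of_nonneg (fun m => planeDensity_nonneg hφ₁ h0 _)
      (summable_planeDensity hφ₁ h0 v), ENNReal.toReal_ofReal (tsum_nonneg fun _ =>
        planeDensity_nonneg hφ₁ h0 _), latticeDensity_eq]
  rw [e]
  have := measurable_planeDensity φ₁ φ₂
  exact (Measurable.tsum fun m => by fun_prop).ennreal_toReal

/-- Folding an integral over the plane against a periodic function onto the torus. -/
lemma integral_planeDensity_smul_eq_torus (hφ₁ : 0 < φ₁) (h0 : 0 < φ₂) {G : Plane → ℂ}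
    (hG : ∀ v m, G (v + period m) = G v)
    (hi : Integrable (fun v => planeDensity φ₁ φ₂ v • G v) specMeasure) :
    ∫ v, planeDensity φ₁ φ₂ v • G v ∂specMeasure =
      ∫ v in torus, latticeDensity φ₁ φ₂ v • G v ∂specMeasure := by
  set F : Plane → ℂ := fun v => planeDensity φ₁ φ₂ v • G v
  set T : ℤ × ℤ → Set Plane := fun m => (fun v => v - period m) ⁻¹' torus with hT
  have hpres : ∀ m, MeasurePreserving (fun v : Plane => v - period m) specMeasure specMeasure :=
    fun m => measurePreserving_sub_right specMeasure (period m)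
  have hemb : ∀ m, MeasurableEmbedding (fun v : Plane => v - period m) :=
    fun m => measurableEmbedding_subRight (period m)
  have hTm : ∀ m, MeasurableSet (T m) := fun m => (hpres m).measurable measurableSet_torus
  have hTd : Pairwise (Function.onFun Disjoint T) := by
    intro m k hmk
    refine Set.disjoint_left.2 fun v hm hk => hmk ?_
    exact (existsUnique_sub_period_mem_torus v).unique hm hk
  have hTu : ⋃ m, T m = Set.univ := by
    refine Set.eq_univ_of_forall fun v => ?_
    obtain ⟨m, hm, -⟩ := existsUnique_sub_period_mem_torus v
    exact Set.mem_iUnion.2 ⟨m, hm⟩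
  have hshift : ∀ {E : Type} [NormedAddCommGroup E] [NormedSpace ℝ E] (H : Plane → E) (m : ℤ × ℤ),
      ∫ v in T m, H v ∂specMeasure = ∫ v in torus, H (v + period m) ∂specMeasure := by
    intro E _ _ H m
    rw [← (hpres m).setIntegral_preimage_emb (hemb m) (fun v => H (v + period m)) torus]
    simp [hT]
  have hFm : ∀ m v, F (v + period m) = planeDensity φ₁ φ₂ (v + period m) • G v := fun m v => by
    simp only [F, hG]
  have hFi : ∀ m, IntegrableOn (fun v => F (v + period m)) torus specMeasure := fun m => by
    rw [← (hpres m).integrableOn_comp_preimage (hemb m)]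
    simpa [Function.comp_def] using hi.integrableOn
  -- Absolute integrability on the plane justifies exchanging the sum over tiles with the integral;
  -- `h1` and `h2` evaluate the same series of tile integrals.
  have hsn : Summable fun m => ∫ v in torus, ‖F (v + period m)‖ ∂specMeasure := by
    have := (hasSum_integral_iUnion hTm hTd (f := fun v => ‖F v‖) hi.norm.integrableOn).summable
    exact this.congr fun m => hshift (fun v => ‖F v‖) m
  have h1 := hasSum_integral_iUnion hTm hTd (f := F) hi.integrableOn
  simp_rw [hshift F, hTu, Measure.restrict_univ] at h1
  have h2 := hasSum_integral_of_summable_integral_norm hFi hsn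
  rw [h1.unique h2]
  congr 1
  ext v
  simp_rw [hFm]
  rw [(summable_planeDensity hφ₁ h0 v).tsum_smul_const, latticeDensity_eq]

lemma norm_one_sub_cexp_le (x : ℝ) : ‖1 - Complex.exp (Complex.I * x)‖ ≤ |x| := by
  rw [norm_sub_rev]
  exact Real.norm_exp_I_mul_ofReal_sub_one_le

lemma norm_one_sub_cexp_le_two (x : ℝ) : ‖1 - Complex.exp (Complex.I * x)‖ ≤ 2 := by
  refine (norm_sub_le _ _).trans ?_
  rw [mul_comm, Complex.norm_exp_ofReal_mul_I, norm_one]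
  norm_num

lemma symbol_one (v : Plane) : symbol 1 v =
    (1 - Complex.exp (Complex.I * (v 0 : ℝ))) * (1 - Complex.exp (Complex.I * (v 1 : ℝ))) := by
  simp [symbol]

lemma norm_symbol_one_sq_le (v : Plane) : ‖symbol 1 v‖ ^ 2 ≤ 16 := by
  rw [symbol_one, norm_mul]
  calc _ ≤ (2 * 2 : ℝ) ^ 2 := by
        gcongr <;> exact norm_one_sub_cexp_le_two _
    _ = 16 := by norm_num

lemma norm_symbol_one_le (v : Plane) : ‖symbol 1 v‖ ≤ ‖v‖ ^ 2 := by
  rw [symbol_one, norm_mul, pow_two]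
  gcongr
  · exact (norm_one_sub_cexp_le _).trans (PiLp.norm_apply_le v 0)
  · exact (norm_one_sub_cexp_le _).trans (PiLp.norm_apply_le v 1)

lemma continuous_symbol (r : ℕ) : Continuous (symbol r) := by
  unfold symbol
  fun_prop

lemma diffDensity_nonneg (hφ₁ : 0 < φ₁) (h0 : 0 < φ₂) (v : Plane) : 0 ≤ diffDensity φ₁ φ₂ v :=
  mul_nonneg (sq_nonneg _) (latticeDensity_nonneg hφ₁ h0 v)

lemma measurable_diffDensity (hφ₁ : 0 < φ₁) (h0 : 0 < φ₂) : Measurable (diffDensity φ₁ φ₂) :=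
  ((continuous_symbol 1).measurable.norm.pow_const 2).mul (measurable_latticeDensity hφ₁ h0)

/-- The symbol is at most `‖v‖²`, so the product is of order `‖v‖ ^ (4 - (2 + 2φ₂)) = ‖v‖ ^ (2 -
2φ₂)`. The exponent is positive as `φ₂ < 1`, which cancels the singularity. -/
lemma norm_symbol_sq_mul_planeDensity_le (hφ₁ : 0 < φ₁) (h0 : 0 < φ₂) (h1 : φ₂ < 1) {v : Plane}
    (hv : v ∈ torus) : ‖symbol 1 v‖ ^ 2 * planeDensity φ₁ φ₂ v ≤
      2 ^ (2 * φ₂ + 2) * Real.pi * Real.Gamma (1 + φ₂) * φ₁ * (2 * Real.pi) ^ (2 - 2 * φ₂) := by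
  have hG : 0 < Real.Gamma (1 + φ₂) := Real.Gamma_pos_of_pos (by linarith)
  rcases eq_or_ne v 0 with rfl | hv0
  · rw [symbol_one]
    simp
    positivity
  · have hn : 0 < ‖v‖ := norm_pos_iff.2 hv0
    calc ‖symbol 1 v‖ ^ 2 * planeDensity φ₁ φ₂ v
        ≤ (‖v‖ ^ 2) ^ 2 * planeDensity φ₁ φ₂ v := by
          gcongr
          · exact planeDensity_nonneg hφ₁ h0 v
          · exact norm_symbol_one_le v
      _ = 2 ^ (2 * φ₂ + 2) * Real.pi * Real.Gamma (1 + φ₂) * φ₁ *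
          (‖v‖ ^ ((4 : ℕ) : ℝ) * ‖v‖ ^ (-(2 + 2 * φ₂))) := by
          rw [planeDensity, Real.rpow_natCast]; ring
      _ = 2 ^ (2 * φ₂ + 2) * Real.pi * Real.Gamma (1 + φ₂) * φ₁ * ‖v‖ ^ (2 - 2 * φ₂) := by
          rw [← Real.rpow_add hn]; congr 2; push_cast; ring
      _ ≤ _ := by
          gcongr ?_ * ?_
          exact Real.rpow_le_rpow hn.le (norm_le_of_mem_torus hv) (by linarith)

/-- The spectral density of the bilinear difference is bounded. -/
lemma exists_diffDensity_le (hφ₁ : 0 < φ₁) (h0 : 0 < φ₂) (h1 : φ₂ < 1) :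
    ∃ M : ℝ, 0 ≤ M ∧ ∀ v ∈ torus, diffDensity φ₁ φ₂ v ≤ M := by
  have hG : 0 < Real.Gamma (1 + φ₂) := Real.Gamma_pos_of_pos (by linarith)
  refine ⟨2 ^ (2 * φ₂ + 2) * Real.pi * Real.Gamma (1 + φ₂) * φ₁ * (2 * Real.pi) ^ (2 - 2 * φ₂) +
    16 * ∑' m, aliasBound φ₁ φ₂ m, ?_, fun v hv => ?_⟩
  · have : 0 ≤ ∑' m, aliasBound φ₁ φ₂ m := tsum_nonneg (aliasBound_nonneg hφ₁ h0)
    positivity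
  · have hite := hasSum_ite_eq (0 : ℤ × ℤ) (planeDensity φ₁ φ₂ v)
    have hle : latticeDensity φ₁ φ₂ v ≤ planeDensity φ₁ φ₂ v + ∑' m, aliasBound φ₁ φ₂ m := by
      rw [latticeDensity_eq, ← hite.tsum_eq, ← hite.summable.tsum_add (summable_aliasBound h0)]
      exact (summable_planeDensity hφ₁ h0 v).tsum_le_tsum (planeDensity_add_period_le' hφ₁ h0 hv)
        (hite.summable.add (summable_aliasBound h0))
    calc diffDensity φ₁ φ₂ v
        ≤ ‖symbol 1 v‖ ^ 2 * (planeDensity φ₁ φ₂ v + ∑' m, aliasBound φ₁ φ₂ m) := by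
          unfold diffDensity; gcongr
      _ = ‖symbol 1 v‖ ^ 2 * planeDensity φ₁ φ₂ v +
          ‖symbol 1 v‖ ^ 2 * ∑' m, aliasBound φ₁ φ₂ m := mul_add _ _ _
      _ ≤ _ := add_le_add (norm_symbol_sq_mul_planeDensity_le hφ₁ h0 h1 hv)
          (mul_le_mul_of_nonneg_right (norm_symbol_one_sq_le v)
            (tsum_nonneg (aliasBound_nonneg hφ₁ h0)))

end Periodization

/-! ### Fourier series on the torus -/

section Torus

open ComplexConjugate

attribute [local instance] instMeasureSpaceUnitAddCircle

lemma isProbabilityMeasure_volume_unitAddCircle :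
    IsProbabilityMeasure (volume : Measure UnitAddCircle) :=
  inferInstanceAs (IsProbabilityMeasure AddCircle.haarAddCircle)

attribute [local instance] isProbabilityMeasure_volume_unitAddCircle

/-- The representative in `(-π, π]²` of a point of the torus `(ℝ/ℤ)²`. -/
noncomputable def torusLift (y : UnitAddTorus (Fin 2)) : Plane :=
  WithLp.toLp 2 fun i => 2 * Real.pi * (AddCircle.equivIoc (1 : ℝ) (-1 / 2) (y i)).1

lemma torusLift_mem (y : UnitAddTorus (Fin 2)) : torusLift y ∈ torus := by
  intro i
  have h := (AddCircle.equivIoc (1 : ℝ) (-1 / 2) (y i)).2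
  have hpi := Real.pi_pos
  simp only [torusLift]
  constructor <;> nlinarith [h.1, h.2]

lemma measurable_torusLift : Measurable torusLift := by
  refine (PiLp.continuous_toLp 2 _).measurable.comp (measurable_pi_lambda _ fun i => ?_)
  exact (measurable_subtype_coe.comp ((AddCircle.measurableEquivIoc 1 (-1 / 2)).measurable.comp
    (measurable_pi_apply i))).const_mul _

/-- The factor `(2π)⁻²` of `specMeasure` is the Jacobian of the scaling by `2π`, so the measure
corresponds to the Haar probability of `(ℝ/ℤ)²`. -/
lemma setIntegral_torus {E : Type*} [NormedAddCommGroup E] [NormedSpace ℝ E] (G : Plane → E) :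
    ∫ v in torus, G v ∂specMeasure = ∫ y : UnitAddTorus (Fin 2), G (torusLift y) := by
  have h1 : ∫ v in torus, G v ∂specMeasure =
      ∫ v : Plane, torus.indicator G ((2 * Real.pi) • v) := by
    rw [Measure.integral_comp_smul, integral_indicator measurableSet_torus, specMeasure,
      Measure.restrict_smul, integral_smul_measure, ENNReal.toReal_ofReal (by positivity),
      finrank_euclideanSpace, Fintype.card_fin, abs_of_nonneg (by positivity)]
  rw [h1, ← (PiLp.volume_preserving_toLp (Fin 2)).integral_comp
    (MeasurableEquiv.toLp 2 (Fin 2 → ℝ)).measurableEmbedding,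
    UnitAddTorus.integral_preimage (fun y => G (torusLift y)) fun _ => -1 / 2]
  have hs : MeasurableSet {x : Fin 2 → ℝ | ∀ i, x i ∈ Set.Ioc (-1 / 2 : ℝ) (-1 / 2 + 1)} :=
    MeasurableSet.univ_pi' fun i => measurableSet_Ioc
  rw [← integral_indicator hs]
  congr 1
  ext x
  have hpi := Real.pi_pos
  have hiff : (2 * Real.pi) • WithLp.toLp 2 x ∈ torus ↔
      x ∈ {x : Fin 2 → ℝ | ∀ i, x i ∈ Set.Ioc (-1 / 2 : ℝ) (-1 / 2 + 1)} := by
    refine forall_congr' fun i => ?_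
    simp only [PiLp.smul_apply, smul_eq_mul, Set.mem_Ioc]
    constructor <;> rintro ⟨h1, h2⟩ <;> constructor <;> nlinarith
  by_cases hx : x ∈ {x : Fin 2 → ℝ | ∀ i, x i ∈ Set.Ioc (-1 / 2 : ℝ) (-1 / 2 + 1)}
  · rw [Set.indicator_of_mem hx, Set.indicator_of_mem (hiff.2 hx)]
    congr 1
    ext i
    simp only [torusLift, PiLp.smul_apply, smul_eq_mul]
    rw [AddCircle.equivIoc_coe_of_mem (hx i)]
  · rw [Set.indicator_of_notMem hx, Set.indicator_of_notMem (fun h => hx (hiff.1 h))]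

lemma mFourier_eq_character (t : ℤ × ℤ) (y : UnitAddTorus (Fin 2)) :
    UnitAddTorus.mFourier ((finTwoArrowEquiv ℤ).symm t) y = character t (torusLift y) := by
  have h : ∀ (n : ℤ) (z : UnitAddCircle), fourier n z = Complex.exp
      (Complex.I * (n * (2 * Real.pi * (AddCircle.equivIoc (1 : ℝ) (-1 / 2) z).1) : ℝ)) := by
    intro n z
    conv_lhs => rw [← AddCircle.coe_equivIoc (p := (1 : ℝ)) (a := -1 / 2) (y := z)]
    rw [fourier_coe_apply]
    congr 1
    push_cast; ring
  simp only [UnitAddTorus.mFourier, ContinuousMap.coe_mk, Fin.prod_univ_two, h, character,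
    ← Complex.exp_add, torusLift, finTwoArrowEquiv_symm_apply]
  congr 1
  push_cast
  ring

lemma conj_character (t : ℤ × ℤ) (v : Plane) : conj (character t v) = character (-t) v := by
  simp only [character, ← Complex.exp_conj, map_mul, Complex.conj_I, Complex.conj_ofReal]
  congr 1; push_cast; simp only [Prod.fst_neg, Prod.snd_neg]; push_cast; ring

lemma character_add (s t : ℤ × ℤ) (v : Plane) :
    character (s + t) v = character s v * character t v := by
  simp only [character, ← Complex.exp_add, Prod.fst_add, Prod.snd_add]
  congr 1; push_cast; ring

lemma norm_character (t : ℤ × ℤ) (v : Plane) : ‖character t v‖ = 1 := by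
  rw [character, mul_comm, Complex.norm_exp_ofReal_mul_I]

lemma continuous_character (t : ℤ × ℤ) : Continuous (character t) := by
  unfold character
  fun_prop

lemma character_add_period (t m : ℤ × ℤ) (v : Plane) :
    character t (v + period m) = character t v := by
  simp only [character, PiLp.add_apply, period_apply_zero, period_apply_one]
  rw [Complex.exp_eq_exp_iff_exists_int]
  exact ⟨t.1 * m.1 + t.2 * m.2, by push_cast; ring⟩

/-- **Parseval's identity** on the torus `(-π, π]²`. -/
lemma hasSum_sq_setIntegral_torus {F : Plane → ℂ} (hF : Measurable F) {M : ℝ}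
    (hM : ∀ v ∈ torus, ‖F v‖ ≤ M) :
    HasSum (fun t : ℤ × ℤ => ‖∫ v in torus, character (-t) v * F v ∂specMeasure‖ ^ 2)
      (∫ v in torus, ‖F v‖ ^ 2 ∂specMeasure) := by
  have hmem : MemLp (fun y => F (torusLift y)) 2 (volume : Measure (UnitAddTorus (Fin 2))) :=
    MemLp.of_bound (hF.comp measurable_torusLift).aestronglyMeasurable M
      (ae_of_all _ fun y => hM _ (torusLift_mem y))
  have h := UnitAddTorus.hasSum_sq_mFourierCoeff hmem.toLp
  rw [← (finTwoArrowEquiv ℤ).symm.hasSum_iff] at h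
  convert h using 1
  · ext t
    simp only [Function.comp, UnitAddTorus.mFourierCoeff]
    rw [setIntegral_torus]
    congr 2
    refine integral_congr_ae ?_
    filter_upwards [hmem.coeFn_toLp] with y hy
    rw [hy, UnitAddTorus.mFourier_neg, mFourier_eq_character, conj_character, smul_eq_mul]
  · rw [setIntegral_torus]
    refine integral_congr_ae ?_
    filter_upwards [hmem.coeFn_toLp] with y hy
    rw [hy]

lemma setIntegral_character_mul_conj (s t : ℤ × ℤ) :
    ∫ v in torus, character s v * conj (character t v) ∂specMeasure = if t = s then 1 else 0 := by
  rw [setIntegral_torus]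
  have h := (orthonormal_iff_ite.1 (UnitAddTorus.orthonormal_mFourier (d := Fin 2)))
    ((finTwoArrowEquiv ℤ).symm t) ((finTwoArrowEquiv ℤ).symm s)
  rw [ContinuousMap.inner_toLp] at h
  simp_rw [mFourier_eq_character, (finTwoArrowEquiv ℤ).symm.injective.eq_iff] at h
  exact h

instance : IsFiniteMeasure (specMeasure.restrict torus) :=
  ⟨by simpa using specMeasure_torus_lt_top⟩

/-- Trigonometric polynomials are isometrically parametrized by their coefficients. -/
lemma setIntegral_norm_sq_trigPolynomial (S : Finset (ℤ × ℤ)) (a : ℤ × ℤ → ℝ) :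
    ∫ v in torus, ‖∑ t ∈ S, a t • character t v‖ ^ 2 ∂specMeasure = ∑ t ∈ S, a t ^ 2 := by
  have hc := continuous_character
  have hint : ∀ s t, Integrable (fun v => ((a s * a t : ℝ) : ℂ) *
      (character s v * conj (character t v))) (specMeasure.restrict torus) := fun s t =>
    (Integrable.of_bound (by fun_prop) 1 (ae_of_all _ fun v => by
      simp [norm_character])).const_mul _
  have e : ∀ v : Plane, ((‖∑ t ∈ S, a t • character t v‖ ^ 2 : ℝ) : ℂ) =
      ∑ s ∈ S, ∑ t ∈ S, ((a s * a t : ℝ) : ℂ) * (character s v * conj (character t v)) := by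
    intro v
    rw [← Complex.normSq_eq_norm_sq, ← Complex.mul_conj, map_sum, Finset.sum_mul_sum]
    refine Finset.sum_congr rfl fun s _ => Finset.sum_congr rfl fun t _ => ?_
    simp only [Complex.real_smul, map_mul, Complex.conj_ofReal]
    push_cast; ring
  have key : ((∫ v in torus, ‖∑ t ∈ S, a t • character t v‖ ^ 2 ∂specMeasure : ℝ) : ℂ) =
      ((∑ t ∈ S, a t ^ 2 : ℝ) : ℂ) := by
    rw [← integral_complex_ofReal]
    simp_rw [e]
    rw [integral_finsetSum _ fun s _ => integrable_finsetSum _ fun t _ => hint s t]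
    simp_rw [integral_finsetSum S fun t _ => hint _ t, integral_const_mul,
      setIntegral_character_mul_conj]
    push_cast
    refine Finset.sum_congr rfl fun s hs => ?_
    simp [hs, pow_two]
  exact_mod_cast key

end Torus

/-! ### Covariances of the bilinear differences and their spectral bounds -/

section Covariance

open ComplexConjugate Matrix

/-- The transfer function `g^{[l+1]} / g^{[1]}` of the coarsening of the bilinear difference. -/
noncomputable def coarsening (l : Fin 2) (v : Plane) : ℂ :=
  if l = 0 then 1 else
    (1 + Complex.exp (Complex.I * (v 0 : ℝ))) * (1 + Complex.exp (Complex.I * (v 1 : ℝ)))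

/-- `1 - z² = (1 - z)(1 + z)` in each coordinate: a step 2 difference is a filtered step 1
difference. -/
lemma symbol_eq_mul_coarsening (l : Fin 2) (v : Plane) :
    symbol (l + 1) v = symbol 1 v * coarsening l v := by
  have h : ∀ z : ℂ, Complex.exp (Complex.I * 2 * z) = Complex.exp (Complex.I * z) ^ 2 := fun z => by
    rw [← Complex.exp_nat_mul]; congr 1; push_cast; ring
  fin_cases l
  · simp [coarsening]
  · simp only [symbol, coarsening]
    simp [h, one_add_one_eq_two]
    ring

lemma norm_one_add_cexp_sq (x : ℝ) :
    ‖1 + Complex.exp (Complex.I * x)‖ ^ 2 = 4 * Real.cos (x / 2) ^ 2 := by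
  rw [← Complex.normSq_eq_norm_sq, mul_comm, Complex.normSq_apply, Complex.add_re, Complex.add_im,
    Complex.exp_ofReal_mul_I_re, Complex.exp_ofReal_mul_I_im, Complex.one_re, Complex.one_im]
  have h := Real.cos_sq (x / 2)
  rw [mul_div_cancel₀ x two_ne_zero] at h
  nlinarith [Real.sin_sq_add_cos_sq x]

lemma norm_coarsening_sq (l : Fin 2) (v : Plane) : ‖coarsening l v‖ ^ 2 = b l v := by
  unfold coarsening b
  split_ifs
  · simp
  · rw [norm_mul, mul_pow, norm_one_add_cexp_sq, norm_one_add_cexp_sq]; ring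

lemma b_le (l : Fin 2) (v : Plane) : b l v ≤ 16 := by
  unfold b
  split_ifs
  · norm_num
  · have h0 := Real.cos_sq_le_one (v 0 / 2)
    have h1 := Real.cos_sq_le_one (v 1 / 2)
    nlinarith [sq_nonneg (Real.cos (v 0 / 2)), sq_nonneg (Real.cos (v 1 / 2))]

lemma norm_coarsening_le (l : Fin 2) (v : Plane) : ‖coarsening l v‖ ≤ 4 := by
  have := (norm_coarsening_sq l v).trans_le (b_le l v)
  nlinarith [norm_nonneg (coarsening l v)]

lemma continuous_coarsening (l : Fin 2) : Continuous (coarsening l) := by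
  unfold coarsening
  split_ifs <;> fun_prop

lemma b_one_eq_div {v : Plane} (hv : symbol 1 v ≠ 0) :
    b 1 v = ‖symbol 2 v‖ ^ 2 / ‖symbol 1 v‖ ^ 2 := by
  have h := symbol_eq_mul_coarsening 1 v
  simp only [Fin.val_one, Nat.reduceAdd] at h
  rw [h, norm_mul, mul_pow, norm_coarsening_sq, mul_div_cancel_left₀]
  positivity

lemma cexp_add_period {x : ℝ} (k : ℤ) :
    Complex.exp (Complex.I * (x + 2 * Real.pi * k : ℝ)) = Complex.exp (Complex.I * x) := by
  rw [Complex.exp_eq_exp_iff_exists_int]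
  exact ⟨k, by push_cast; ring⟩

lemma symbol_one_add_period (v : Plane) (m : ℤ × ℤ) : symbol 1 (v + period m) = symbol 1 v := by
  simp only [symbol_one, PiLp.add_apply, period_apply_zero, period_apply_one, cexp_add_period]

lemma coarsening_add_period (l : Fin 2) (v : Plane) (m : ℤ × ℤ) :
    coarsening l (v + period m) = coarsening l v := by
  simp only [coarsening, PiLp.add_apply, period_apply_zero, period_apply_one, cexp_add_period]

variable {φ₁ φ₂ : ℝ}

/-- The cross-spectral density of the bilinear differences at steps `l + 1` and `m + 1`. -/
noncomputable def crossDensity (φ₁ φ₂ : ℝ) (l m : Fin 2) (v : Plane) : ℂ :=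
  diffDensity φ₁ φ₂ v • (coarsening l v * conj (coarsening m v))

lemma norm_crossDensity_sq (l m : Fin 2) (v : Plane) :
    ‖crossDensity φ₁ φ₂ l m v‖ ^ 2 = b l v * b m v * diffDensity φ₁ φ₂ v ^ 2 := by
  rw [crossDensity, norm_smul, norm_mul, RCLike.norm_conj, mul_pow, mul_pow, norm_coarsening_sq,
    norm_coarsening_sq, Real.norm_eq_abs, sq_abs, mul_comm]

lemma measurable_crossDensity (hφ₁ : 0 < φ₁) (h0 : 0 < φ₂) (l m : Fin 2) :
    Measurable (crossDensity φ₁ φ₂ l m) := by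
  have hl := continuous_coarsening l
  have hm := continuous_coarsening m
  exact (measurable_diffDensity hφ₁ h0).smul
    (by fun_prop : Continuous fun v => coarsening l v * conj (coarsening m v)).measurable

lemma exists_norm_crossDensity_le (hφ₁ : 0 < φ₁) (h0 : 0 < φ₂) (h1 : φ₂ < 1) :
    ∃ M, ∀ l m, ∀ v ∈ torus, ‖crossDensity φ₁ φ₂ l m v‖ ≤ M := by
  obtain ⟨M, hM, hb⟩ := exists_diffDensity_le hφ₁ h0 h1
  refine ⟨M * (4 * 4), fun l m v hv => ?_⟩
  rw [crossDensity, norm_smul, norm_mul, RCLike.norm_conj,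
    Real.norm_of_nonneg (diffDensity_nonneg hφ₁ h0 v)]
  gcongr
  · exact hb v hv
  · exact norm_coarsening_le l v
  · exact norm_coarsening_le m v

/-- Symbols and lattice characters have period `2π`, so the plane integral folds. The sites enter
only through a character of `s - t`, which is the stationarity of the differences. -/
lemma covForm_stencil_eq_setIntegral (hφ₁ : 0 < φ₁) (h0 : 0 < φ₂) (h1 : φ₂ < 1) (l m : Fin 2)
    (s t : ℤ × ℤ) :
    (covForm (genCov φ₁ φ₂) (stencil (l + 1) s) (stencil (m + 1) t) : ℂ) =
      ∫ v in torus, character (s - t) v * crossDensity φ₁ φ₂ l m v ∂specMeasure := by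
  obtain ⟨hi, hv⟩ := integral_planeDensity_smul_transform hφ₁ h0 h1
    (mass_stencil (l + 1) s) (mass_stencil (m + 1) t)
  rw [← hv, integral_planeDensity_smul_eq_torus hφ₁ h0 _ hi]
  · congr 1
    ext v
    simp only [transform_stencil, symbol_eq_mul_coarsening, crossDensity, diffDensity, map_mul,
      conj_character, sub_eq_add_neg, character_add, Complex.real_smul]
    rw [Complex.ofReal_mul, Complex.ofReal_pow, ← Complex.mul_conj']
    ring
  · intro v k
    simp only [transform_stencil, symbol_eq_mul_coarsening, character_add_period,
      symbol_one_add_period, coarsening_add_period]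

/-- The covariance of the bilinear differences at steps `l + 1` and `m + 1`, at lag `h`. -/
noncomputable def diffCov (φ₁ φ₂ : ℝ) (l m : Fin 2) (h : ℤ × ℤ) : ℝ :=
  covForm (genCov φ₁ φ₂) (stencil (l + 1) h) (stencil (m + 1) 0)

lemma covForm_stencil (hφ₁ : 0 < φ₁) (h0 : 0 < φ₂) (h1 : φ₂ < 1) (l m : Fin 2) (s t : ℤ × ℤ) :
    covForm (genCov φ₁ φ₂) (stencil (l + 1) s) (stencil (m + 1) t) =
      diffCov φ₁ φ₂ l m (s - t) := by
  rw [← Complex.ofReal_inj, diffCov, covForm_stencil_eq_setIntegral hφ₁ h0 h1,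
    covForm_stencil_eq_setIntegral hφ₁ h0 h1, sub_zero]

/-- The squared covariances sum to the entries of the limiting matrix. -/
lemma hasSum_diffCov_sq (hφ₁ : 0 < φ₁) (h0 : 0 < φ₂) (h1 : φ₂ < 1) (l m : Fin 2) :
    HasSum (fun h => diffCov φ₁ φ₂ l m h ^ 2) (limitCov φ₁ φ₂ l m / 2) := by
  obtain ⟨M, hM⟩ := exists_norm_crossDensity_le hφ₁ h0 h1
  have h := hasSum_sq_setIntegral_torus (measurable_crossDensity hφ₁ h0 l m) (hM l m)
  -- Parseval's coefficient at `t` is the covariance at lag `-t`.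
  rw [← (Equiv.neg (ℤ × ℤ)).hasSum_iff] at h
  convert h using 1
  · ext t
    have := covForm_stencil_eq_setIntegral hφ₁ h0 h1 l m t 0
    rw [sub_zero] at this
    simp only [Function.comp, Equiv.neg_apply, neg_neg]
    rw [← this, Complex.norm_real, Real.norm_eq_abs, sq_abs, diffCov]
  · simp only [norm_crossDensity_sq, limitCov]
    ring

lemma integrableOn_b_mul_b_mul_diffDensity_sq (hφ₁ : 0 < φ₁) (h0 : 0 < φ₂) (h1 : φ₂ < 1)
    (l m : Fin 2) :
    IntegrableOn (fun v => b l v * b m v * diffDensity φ₁ φ₂ v ^ 2) torus specMeasure := by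
  obtain ⟨M, hM⟩ := exists_norm_crossDensity_le hφ₁ h0 h1
  simp_rw [← norm_crossDensity_sq]
  refine Integrable.of_bound
    ((measurable_crossDensity hφ₁ h0 l m).norm.pow_const 2).aestronglyMeasurable (M ^ 2)
    ((ae_restrict_iff' measurableSet_torus).2 (ae_of_all _ fun v hv => ?_))
  rw [norm_pow, norm_norm]
  gcongr
  exact hM l m v hv

/-- `Σ` is a Gram matrix: its quadratic form is twice the integral of a square. -/
lemma posSemidef_limitCov (hφ₁ : 0 < φ₁) (h0 : 0 < φ₂) (h1 : φ₂ < 1) :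
    (limitCov φ₁ φ₂).PosSemidef := by
  have hi := integrableOn_b_mul_b_mul_diffDensity_sq hφ₁ h0 h1
  refine PosSemidef.of_dotProduct_mulVec_nonneg ?_ fun x => ?_
  · ext l m
    simp [limitCov, mul_comm (b l _)]
  · have : star x ⬝ᵥ limitCov φ₁ φ₂ *ᵥ x =
        2 * ∫ v in torus, ((∑ l, x l * b l v) * diffDensity φ₁ φ₂ v) ^ 2 ∂specMeasure := by
      have e : ∀ v, ((∑ l, x l * b l v) * diffDensity φ₁ φ₂ v) ^ 2 =
          ∑ l, ∑ m, x l * x m * (b l v * b m v * diffDensity φ₁ φ₂ v ^ 2) := fun v => by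
        rw [mul_pow, pow_two (Finset.sum _ _), Finset.sum_mul_sum, Finset.sum_mul]
        refine Finset.sum_congr rfl fun l _ => ?_
        rw [Finset.sum_mul]
        exact Finset.sum_congr rfl fun m _ => by ring
      simp_rw [e]
      rw [integral_finsetSum _ fun l _ => integrable_finsetSum _ fun m _ => (hi l m).const_mul _]
      simp_rw [integral_finsetSum _ fun m _ => (hi _ m).const_mul _, integral_const_mul, star_trivial]
      simp only [dotProduct, mulVec, limitCov, Finset.mul_sum]
      exact Finset.sum_congr rfl fun l _ => Finset.sum_congr rfl fun m _ => by ring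
    rw [this]
    exact mul_nonneg zero_le_two (integral_nonneg fun v => sq_nonneg _)

/-- The covariance matrices of finite families of bilinear differences are uniformly bounded. -/
lemma exists_dotProduct_covMatrix_stencil_le (hφ₁ : 0 < φ₁) (h0 : 0 < φ₂) (h1 : φ₂ < 1) :
    ∃ K : ℝ, 0 ≤ K ∧ ∀ (S : Fin 2 → Finset (ℤ × ℤ)) (x : (Σ l, S l) → ℝ),
      x ⬝ᵥ covMatrix (genCov φ₁ φ₂) (fun i : Σ l, S l => stencil (i.1 + 1) i.2) *ᵥ x ≤
        K * ∑ i, x i ^ 2 := by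
  obtain ⟨M, hM, hb⟩ := exists_diffDensity_le hφ₁ h0 h1
  -- `32 = 2 * 4²`: each of the two filters is bounded by `4`, and `(α + β)² ≤ 2(α² + β²)`.
  refine ⟨M * 32, by positivity, fun S x => ?_⟩
  rw [dotProduct_covMatrix_mulVec]
  set C : Plane →₀ ℝ := ∑ i : Σ l, S l, x i • stencil (i.1 + 1) i.2
  have hC : mass C = 0 := by simp [C, map_sum, mass_stencil]
  set a : Fin 2 → ℤ × ℤ → ℝ := fun l t => if h : t ∈ S l then x ⟨l, t, h⟩ else 0 with ha
  set p : Fin 2 → Plane → ℂ := fun l v => ∑ t ∈ S l, a l t • character t v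
  set q : Plane → ℂ := fun v => ∑ l, coarsening l v * p l v
  have hx : ∀ (l : Fin 2) (t : S l), a l t = x ⟨l, t⟩ := fun l t => by
    simp [ha]
  -- The quadratic form is the variance of the increment `C`. Bounding the density by `M` leaves
  -- trigonometric polynomials, whose `L²` norms are those of their coefficients.
  have hT : ∀ v, transform v C = symbol 1 v * q v := fun v => by
    simp only [C, q, p, map_sum, map_smul, transform_stencil, symbol_eq_mul_coarsening,
      Fintype.sum_sigma, Finset.mul_sum]
    refine Finset.sum_congr rfl fun l _ => ?_
    rw [← Finset.sum_coe_sort (S l)]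
    refine Finset.sum_congr rfl fun t _ => ?_
    rw [hx, Complex.real_smul, Complex.real_smul]
    ring
  have hpc : ∀ l, Continuous (p l) := fun l => by
    have := continuous_character
    fun_prop
  have hqc : Continuous q := by
    have := continuous_coarsening
    fun_prop
  have hper : ∀ v m, q (v + period m) = q v := fun v m => by
    simp only [q, p, coarsening_add_period, character_add_period]
  obtain ⟨hi, hv⟩ := integral_planeDensity_smul_transform hφ₁ h0 h1 hC hC
  rw [integral_planeDensity_smul_eq_torus hφ₁ h0 (fun v m => by
    simp only [hT, symbol_one_add_period, hper]) hi] at hv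
  have hval : ∫ v in torus, diffDensity φ₁ φ₂ v * ‖q v‖ ^ 2 ∂specMeasure =
      covForm (genCov φ₁ φ₂) C C := by
    rw [← Complex.ofReal_inj, ← hv, ← integral_complex_ofReal]
    congr 1
    ext v
    rw [hT, Complex.mul_conj', diffDensity, norm_mul, Complex.real_smul]
    push_cast
    ring
  have hpb : ∀ l, Integrable (fun v => ‖p l v‖ ^ 2) (specMeasure.restrict torus) := fun l => by
    refine Integrable.of_bound (by fun_prop) ((∑ t ∈ S l, |a l t|) ^ 2) (ae_of_all _ fun v => ?_)
    rw [norm_pow, norm_norm]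
    gcongr
    refine (norm_sum_le _ _).trans (Finset.sum_le_sum fun t _ => ?_)
    rw [norm_smul, norm_character, mul_one, Real.norm_eq_abs]
  rw [← hval]
  calc ∫ v in torus, diffDensity φ₁ φ₂ v * ‖q v‖ ^ 2 ∂specMeasure
      ≤ ∫ v in torus, M * (32 * ∑ l, ‖p l v‖ ^ 2) ∂specMeasure := by
        refine integral_mono_of_nonneg (ae_of_all _ fun v => ?_)
          (((integrable_finsetSum _ fun l _ => hpb l).const_mul _).const_mul _)
          ((ae_restrict_iff' measurableSet_torus).2 (ae_of_all _ fun v hv => ?_))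
        · exact mul_nonneg (diffDensity_nonneg hφ₁ h0 v) (sq_nonneg _)
        · have hq : ‖q v‖ ≤ ∑ l, 4 * ‖p l v‖ := (norm_sum_le _ _).trans
            (Finset.sum_le_sum fun l _ => by
              rw [norm_mul]; gcongr; exact norm_coarsening_le l v)
          have hq2 : ‖q v‖ ^ 2 ≤ 32 * ∑ l, ‖p l v‖ ^ 2 := by
            rw [Fin.sum_univ_two] at hq ⊢
            calc ‖q v‖ ^ 2 ≤ (4 * ‖p 0 v‖ + 4 * ‖p 1 v‖) ^ 2 := by gcongr
              _ ≤ _ := by nlinarith [sq_nonneg (‖p 0 v‖ - ‖p 1 v‖)]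
          exact mul_le_mul (hb v hv) hq2 (sq_nonneg _) hM
    _ = M * 32 * ∑ i, x i ^ 2 := by
        rw [integral_const_mul, integral_const_mul, integral_finsetSum _ fun l _ => hpb l,
          Fintype.sum_sigma, ← mul_assoc]
        congr 1
        refine Finset.sum_congr rfl fun l _ => ?_
        rw [setIntegral_norm_sq_trigPolynomial, ← Finset.sum_coe_sort (S l)]
        exact Finset.sum_congr rfl fun t _ => by rw [hx]

end Covariance

/-! ### Double sums over squares, grouped by lag -/

section Counting

lemma card_square (k : ℕ) : ((square k).card : ℝ) = (k : ℝ) ^ 2 := by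
  simp [square, pow_two]

/-- The number of `j ∈ {0, …, q-1}` with `j + k ∈ {0, …, p-1}`. -/
noncomputable def overlap (p q : ℕ) (k : ℤ) : ℕ :=
  ((Finset.Ico (0 : ℤ) q).filter fun j => j + k ∈ Finset.Ico (0 : ℤ) p).card

lemma overlap_le (p q : ℕ) (k : ℤ) : (overlap p q k : ℝ) ≤ q := by
  have : overlap p q k ≤ (Finset.Ico (0 : ℤ) q).card := Finset.card_filter_le _ _
  simp only [Int.card_Ico, sub_zero, Int.toNat_natCast] at this
  exact_mod_cast this

lemma le_overlap (p q : ℕ) (k : ℤ) : min (p : ℝ) q - |(k : ℝ)| ≤ overlap p q k := by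
  have e : ((Finset.Ico (0 : ℤ) q).filter fun j => j + k ∈ Finset.Ico (0 : ℤ) p) =
      Finset.Ico (max 0 (-k)) (min (q : ℤ) (p - k)) := by
    ext j
    simp only [Finset.mem_filter, Finset.mem_Ico]
    omega
  have h : min (p : ℤ) q - |k| ≤ (overlap p q k : ℤ) := by
    rw [overlap, e, Int.card_Ico]
    rcases abs_cases k with ⟨h, _⟩ | ⟨h, _⟩ <;> omega
  exact_mod_cast h

lemma card_filter_square (p q : ℕ) (h : ℤ × ℤ) :
    ((square q).filter fun t => t + h ∈ square p).card = overlap p q h.1 * overlap p q h.2 := by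
  rw [overlap, overlap, ← Finset.card_product, ← Finset.filter_product]
  simp only [square, Finset.mem_product, Prod.fst_add, Prod.snd_add]

/-- Pairs are grouped by their lag `h`; the number of pairs with a given lag factorizes over the
coordinates. -/
lemma sum_square_sub (F : ℤ × ℤ → ℝ) (p q : ℕ) :
    ∑ s ∈ square p, ∑ t ∈ square q, F (s - t) =
      ∑' h : ℤ × ℤ, (overlap p q h.1 * overlap p q h.2 : ℝ) * F h := by
  have h1 : ∀ t : ℤ × ℤ, HasSum (fun h => if t + h ∈ square p then F h else 0)
      (∑ s ∈ square p, F (s - t)) := fun t => by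
    rw [← (Equiv.subRight t).hasSum_iff]
    have : HasSum (fun s => if s ∈ square p then F (s - t) else 0)
        (∑ s ∈ square p, if s ∈ square p then F (s - t) else 0) :=
      hasSum_sum_of_ne_finset_zero fun s hs => by simp [hs]
    rw [Finset.sum_congr rfl fun s hs => if_pos hs] at this
    refine this.congr_fun ?_
    intro s
    simp
  rw [Finset.sum_comm, ← (hasSum_sum fun t (_ : t ∈ square q) => h1 t).tsum_eq]
  congr 1
  ext h
  rw [← Finset.sum_filter, Finset.sum_const, card_filter_square, nsmul_eq_mul, Nat.cast_mul]

lemma le_natCast_sub (n a : ℕ) : (n : ℝ) - a ≤ ((n - a : ℕ) : ℝ) := by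
  rw [sub_le_iff_le_add]
  exact_mod_cast (by omega : n ≤ n - a + a)

lemma tendsto_natCast_sub_const_div (c : ℝ) :
    Tendsto (fun n : ℕ => ((n : ℝ) - c) / n) atTop (𝓝 1) := by
  have h := (tendsto_const_div_atTop_nhds_zero_nat c).const_sub 1
  rw [sub_zero] at h
  refine h.congr' ?_
  filter_upwards [eventually_gt_atTop 0] with n hn
  have : (n : ℝ) ≠ 0 := by positivity
  field_simp

/-- For a fixed lag the boundary costs at most `a + b + |k|` sites, negligible against `n`. -/
lemma tendsto_overlap_div (a b : ℕ) (k : ℤ) :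
    Tendsto (fun n : ℕ => (overlap (n - a) (n - b) k : ℝ) / n) atTop (𝓝 1) := by
  refine tendsto_of_tendsto_of_tendsto_of_le_of_le
    (tendsto_natCast_sub_const_div (a + b + |(k : ℝ)|)) tendsto_const_nhds (fun n => ?_)
    fun n => ?_
  · have h1 := le_overlap (n - a) (n - b) k
    have h2 : (n : ℝ) - (a + b) ≤ min ((n - a : ℕ) : ℝ) ((n - b : ℕ) : ℝ) := by
      have := le_natCast_sub n a
      have := le_natCast_sub n b
      have : (0 : ℝ) ≤ a := by positivity
      have : (0 : ℝ) ≤ b := by positivity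
      exact le_min (by linarith) (by linarith)
    simp only
    gcongr
    linarith
  · refine div_le_one_of_le₀ ((overlap_le _ _ _).trans ?_) (by positivity)
    exact_mod_cast Nat.sub_le n b

lemma tendsto_natCast_div_sub (a : ℕ) :
    Tendsto (fun n : ℕ => (n : ℝ) / ((n - a : ℕ) : ℝ)) atTop (𝓝 1) := by
  have h := (tendsto_natCast_sub_const_div a).inv₀ one_ne_zero
  rw [inv_one] at h
  refine h.congr' ?_
  filter_upwards [eventually_ge_atTop a] with n hn
  rw [inv_div, Nat.cast_sub hn]

/-- The normalized double sum of a summable function of the difference converges to its sum. -/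
lemma tendsto_sum_square_sub {F : ℤ × ℤ → ℝ} (hF : Summable F) (a b : ℕ) :
    Tendsto (fun n : ℕ => (n : ℝ) ^ 2 / ((n - a : ℕ) ^ 2 * (n - b : ℕ) ^ 2 : ℝ) *
      ∑ s ∈ square (n - a), ∑ t ∈ square (n - b), F (s - t)) atTop (𝓝 (∑' h, F h)) := by
  simp_rw [sum_square_sub, ← tsum_mul_left, ← mul_assoc]
  -- The factor `4` is `2²`: eventually `n / (n - a) ≤ 2`, while each overlap is at most `n - b`.
  refine tendsto_tsum_of_dominated_convergence (bound := fun h => 4 * ‖F h‖) (hF.norm.mul_left 4)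
    (fun h => ?_) ?_
  · have hlim := (((tendsto_natCast_div_sub a).pow 2).mul ((tendsto_natCast_div_sub b).pow 2)).mul
      ((tendsto_overlap_div a b h.1).mul (tendsto_overlap_div a b h.2))
    simp only [one_pow, mul_one] at hlim
    have := hlim.mul_const (F h)
    rw [one_mul] at this
    refine this.congr' ?_
    filter_upwards [eventually_gt_atTop (a + b)] with n hn
    have h1 : (n : ℝ) ≠ 0 := by
      have : n ≠ 0 := by omega
      exact_mod_cast this
    have h2 : ((n - a : ℕ) : ℝ) ≠ 0 := by
      have : n - a ≠ 0 := by omega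
      exact_mod_cast this
    have h3 : ((n - b : ℕ) : ℝ) ≠ 0 := by
      have : n - b ≠ 0 := by omega
      exact_mod_cast this
    field_simp
  · have hev := (tendsto_natCast_div_sub a).eventually_le_const (show (1 : ℝ) < 2 by norm_num)
    filter_upwards [hev] with n hn h
    rw [norm_mul]
    gcongr
    rw [Real.norm_of_nonneg (by positivity)]
    have h1 := overlap_le (n - a) (n - b) h.1
    have h2 := overlap_le (n - a) (n - b) h.2
    calc (n : ℝ) ^ 2 / ((n - a : ℕ) ^ 2 * (n - b : ℕ) ^ 2 : ℝ) * overlap (n - a) (n - b) h.1 *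
          overlap (n - a) (n - b) h.2
        = ((n : ℝ) / (n - a : ℕ)) ^ 2 *
          ((overlap (n - a) (n - b) h.1 / (n - b : ℕ)) * (overlap (n - a) (n - b) h.2 /
            (n - b : ℕ))) := by ring
      _ ≤ 2 ^ 2 * (1 * 1) := by
          gcongr
          · exact div_le_one_of_le₀ h1 (by positivity)
          · exact div_le_one_of_le₀ h2 (by positivity)
      _ = 4 := by norm_num

end Counting

/-! ### Convergence of the characteristic functions -/

section CentralLimitTheorem

open Matrix

variable {φ₁ φ₂ : ℝ}

lemma genCov_neg (φ₁ φ₂ : ℝ) (h : Plane) : genCov φ₁ φ₂ (-h) = genCov φ₁ φ₂ h := by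
  simp [genCov]

variable {Ω : Type*} [MeasurableSpace Ω] {P : Measure Ω} {X : Plane → Ω → ℝ} {K : Plane → ℝ}

lemma IsGaussianIRF0.integrable_bilinDiff_sq (hX : IsGaussianIRF0 P X K) (r : ℕ) (t : ℤ × ℤ) :
    Integrable (fun ω => bilinDiff X r t ω ^ 2) P := by
  rw [← increment_stencil]
  exact (hX.hasGaussianLaw (mass_stencil r t)).memLp_two.integrable_sq

lemma IsGaussianIRF0.integrable_quadVar (hX : IsGaussianIRF0 P X K) (r n : ℕ) :
    Integrable (quadVar X r n) P :=
  (integrable_finsetSum _ fun t _ => hX.integrable_bilinDiff_sq r t).div_const _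

lemma IsGaussianIRF0.integral_quadVar (hX : IsGaussianIRF0 P X K) (r n : ℕ) :
    ∫ ω, quadVar X r n ω ∂P = (∑ t ∈ square (n - 2 * r), covForm K (stencil r t) (stencil r t)) /
      ((square (n - 2 * r)).card : ℝ) := by
  simp only [quadVar]
  rw [integral_div, integral_finsetSum _ fun t _ => hX.integrable_bilinDiff_sq r t]
  simp_rw [← increment_stencil, hX.integral_increment_sq (mass_stencil r _)]

/-- The sites of `Q_{l+1}`. -/
noncomputable def sites (n : ℕ) (l : Fin 2) : Finset (ℤ × ℤ) := square (n - 2 * (l + 1))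

/-- The coefficient of the squared bilinear differences at step `l + 1` in the linear combination
of the normalized quadratic variations with coefficients `y`. -/
noncomputable def weight (y : Fin 2 → ℝ) (n : ℕ) (l : Fin 2) : ℝ := y l * n / (sites n l).card

/-- Indexing by the disjoint union of the two site sets makes both variations a single diagonal
form, so joint convergence needs no separate argument. -/
lemma sum_normalized_eq (hX : IsGaussianIRF0 P X K) (y : Fin 2 → ℝ) (n : ℕ) (ω : Ω) :
    ∑ l : Fin 2, y l * (n * (quadVar X (l + 1) n ω - ∫ ω', quadVar X (l + 1) n ω' ∂P)) =
      ∑ i : Σ l, sites n l, weight y n i.1 * (increment X (stencil (i.1 + 1) i.2) ω ^ 2 -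
        covForm K (stencil (i.1 + 1) i.2) (stencil (i.1 + 1) i.2)) := by
  rw [Fintype.sum_sigma]
  refine Finset.sum_congr rfl fun l _ => ?_
  rw [hX.integral_quadVar, quadVar]
  simp only [increment_stencil]
  rw [Finset.sum_coe_sort (sites n l) fun t => weight y n l *
    (bilinDiff X (l + 1) t ω ^ 2 - covForm K (stencil (l + 1) t) (stencil (l + 1) t)),
    ← Finset.mul_sum, Finset.sum_sub_distrib, weight, sites]
  ring

/-- The weight is `n` over a number of sites of order `n²`, hence of order `1 / n`. -/
lemma tendsto_weight (y : Fin 2 → ℝ) (l : Fin 2) :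
    Tendsto (fun n => weight y n l) atTop (𝓝 0) := by
  have h := (((tendsto_natCast_div_sub (2 * (l + 1))).pow 2).mul
    (tendsto_const_div_atTop_nhds_zero_nat 1)).const_mul (y l)
  rw [mul_zero, mul_zero] at h
  refine h.congr' ?_
  filter_upwards [eventually_gt_atTop 0] with n hn
  have : (n : ℝ) ≠ 0 := by positivity
  rw [weight, sites, card_square]
  field_simp

/-- Each pair `(l, m)` of steps contributes a normalized sum over lags of `diffCov ^ 2`, with limit
`Σ l m / 2`. The half becomes that of the Gaussian exponent. -/
lemma tendsto_sum_weight_mul_covForm_sq (hφ₁ : 0 < φ₁) (h0 : 0 < φ₂) (h1 : φ₂ < 1)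
    (y : Fin 2 → ℝ) :
    Tendsto (fun n => ∑ i : Σ l, sites n l, ∑ j : Σ l, sites n l,
      weight y n i.1 * weight y n j.1 * covForm (genCov φ₁ φ₂)
        (stencil (i.1 + 1) i.2) (stencil (j.1 + 1) j.2) ^ 2) atTop
      (𝓝 ((y ⬝ᵥ limitCov φ₁ φ₂ *ᵥ y) / 2)) := by
  have hlim : ∀ l m : Fin 2, Tendsto (fun n : ℕ => y l * y m *
      ((n : ℝ) ^ 2 / ((n - 2 * (l + 1) : ℕ) ^ 2 * (n - 2 * (m + 1) : ℕ) ^ 2 : ℝ) *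
        ∑ s ∈ sites n l, ∑ t ∈ sites n m, diffCov φ₁ φ₂ l m (s - t) ^ 2)) atTop
      (𝓝 (y l * y m * (limitCov φ₁ φ₂ l m / 2))) := fun l m => by
    have hs := hasSum_diffCov_sq hφ₁ h0 h1 l m
    rw [← hs.tsum_eq]
    exact (tendsto_sum_square_sub hs.summable _ _).const_mul _
  have hsum := tendsto_finsetSum Finset.univ fun l _ =>
    tendsto_finsetSum (Finset.univ : Finset (Fin 2)) fun m _ => hlim l m
  have e : (y ⬝ᵥ limitCov φ₁ φ₂ *ᵥ y) / 2 =
      ∑ l, ∑ m, y l * y m * (limitCov φ₁ φ₂ l m / 2) := by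
    simp only [dotProduct, mulVec, Finset.mul_sum, Finset.sum_div]
    exact Finset.sum_congr rfl fun l _ => Finset.sum_congr rfl fun m _ => by ring
  rw [e]
  refine hsum.congr fun n => ?_
  simp only [Fintype.sum_sigma, covForm_stencil hφ₁ h0 h1]
  refine Finset.sum_congr rfl fun l _ => ?_
  rw [Finset.sum_comm]
  refine Finset.sum_congr rfl fun m _ => ?_
  have inner_sum : ∀ s : ℤ × ℤ, ∑ t : sites n m, weight y n l * weight y n m *
      diffCov φ₁ φ₂ l m (s - t) ^ 2 = weight y n l * weight y n m *
        ∑ t ∈ sites n m, diffCov φ₁ φ₂ l m (s - t) ^ 2 := fun s => by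
    rw [Finset.mul_sum, Finset.sum_coe_sort (sites n m) fun t => weight y n l * weight y n m *
      diffCov φ₁ φ₂ l m (s - t) ^ 2]
  simp only [inner_sum]
  rw [Finset.sum_coe_sort (sites n l) fun s => weight y n l * weight y n m *
    ∑ t ∈ sites n m, diffCov φ₁ φ₂ l m (s - t) ^ 2, ← Finset.mul_sum, ← mul_assoc]
  congr 1
  rw [weight, weight, sites, sites, card_square, card_square]
  ring

lemma inner_normalizedVar (n : ℕ) (ω : Ω) (y : EuclideanSpace ℝ (Fin 2)) :
    inner ℝ (normalizedVar P X n ω) y = ∑ l : Fin 2, y l *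
      (n * (quadVar X (l + 1) n ω - ∫ ω', quadVar X (l + 1) n ω' ∂P)) := by
  simp [normalizedVar, PiLp.inner_apply, Fin.sum_univ_two, Real.sqrt_sq, mul_comm,
    one_add_one_eq_two]

lemma IsGaussianIRF0.aemeasurable_normalizedVar (hX : IsGaussianIRF0 P X K) (n : ℕ) :
    AEMeasurable (normalizedVar P X n) P := by
  have h1 := (hX.integrable_quadVar 1 n).aemeasurable
  have h2 := (hX.integrable_quadVar 2 n).aemeasurable
  refine AEMeasurable.const_smul (M := ℝ) ((WithLp.measurable_toLp 2
    (Fin 2 → ℝ)).comp_aemeasurable (aemeasurable_pi_lambda _ fun i => ?_)) _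
  fin_cases i
  · exact h1.sub_const _
  · exact h2.sub_const _

variable [IsProbabilityMeasure P]

/-- Quadratic forms in increments with small coefficients are almost Gaussian, uniformly in their
number. -/
lemma IsGaussianIRF0.exists_norm_integral_cexp_sub_le (hX : IsGaussianIRF0 P X K)
    (hK : ∀ h, K (-h) = K h) {ε : ℝ} (hε : 0 < ε) :
    ∃ δ > 0, ∀ {ι : Type} [Fintype ι] [DecidableEq ι] {c : ι → Plane →₀ ℝ},
      (∀ i, mass (c i) = 0) → ∀ (w : ι → ℝ) (B m : ℝ),
      (∀ x : ι → ℝ, x ⬝ᵥ covMatrix K c *ᵥ x ≤ B * ∑ i, x i ^ 2) → (∀ i, |w i| ≤ m) → m * B ≤ δ →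
      ‖(∫ ω, Complex.exp (Complex.I * (∑ i, w i * (increment X (c i) ω ^ 2 -
          covForm K (c i) (c i)) : ℝ)) ∂P) -
        Complex.exp ((-∑ i, ∑ j, w i * w j * covForm K (c i) (c j) ^ 2 : ℝ) : ℂ)‖ ≤
        ε * ∑ i, ∑ j, w i * w j * covForm K (c i) (c j) ^ 2 := by
  obtain ⟨δ, hδ, h⟩ := exists_norm_integral_cexp_quadratic_sub_le hε
  refine ⟨δ, hδ, fun {ι _ _ c} hc w B m hB hw hm => ?_⟩
  have hmeas : AEMeasurable (fun ω => WithLp.toLp 2 fun i => increment X (c i) ω) P :=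
    (PiLp.continuous_toLp 2 _).measurable.comp_aemeasurable
      (aemeasurable_pi_lambda _ fun i => (hX.hasGaussianLaw (hc i)).aemeasurable)
  have hq := h (hX.posSemidef_covMatrix hK hc) w B m hB hw hm
  rw [← hX.map_increments hK hc, integral_map hmeas (by fun_prop)] at hq
  exact hq

/-- The characteristic function of the normalized quadratic variations converges. -/
lemma IsGaussianIRF0.tendsto_integral_cexp_normalized (hX : IsGaussianIRF0 P X (genCov φ₁ φ₂))
    (hφ₁ : 0 < φ₁) (h0 : 0 < φ₂) (h1 : φ₂ < 1) (y : Fin 2 → ℝ) :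
    Tendsto (fun n : ℕ => ∫ ω, Complex.exp (Complex.I * (∑ l : Fin 2, y l *
      (n * (quadVar X (l + 1) n ω - ∫ ω', quadVar X (l + 1) n ω' ∂P)) : ℝ)) ∂P) atTop
      (𝓝 (Complex.exp ((-((y ⬝ᵥ limitCov φ₁ φ₂ *ᵥ y) / 2) : ℝ) : ℂ))) := by
  have hV := tendsto_sum_weight_mul_covForm_sq hφ₁ h0 h1 y
  obtain ⟨B, hB, hbound⟩ := exists_dotProduct_covMatrix_stencil_le hφ₁ h0 h1
  have hw : Tendsto (fun n => (|weight y n 0| + |weight y n 1|) * B) atTop (𝓝 0) := by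
    simpa using ((tendsto_weight y 0).abs.add (tendsto_weight y 1).abs).mul_const B
  have hle : ∀ n (i : Σ l, sites n l), |weight y n i.1| ≤ |weight y n 0| + |weight y n 1| := by
    rintro n ⟨l, t⟩
    have h0 := abs_nonneg (weight y n 0)
    have h1 := abs_nonneg (weight y n 1)
    fin_cases l <;> simp
  have hexp := ((Complex.continuous_exp.comp Complex.continuous_ofReal).tendsto _).comp hV.neg
  refine Tendsto.congr_dist hexp ?_
  rw [Metric.tendsto_nhds]
  intro ε hε
  set V₀ := (y ⬝ᵥ limitCov φ₁ φ₂ *ᵥ y) / 2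
  have hV₀ : 0 < |V₀| + 1 := by positivity
  -- The variance sums are eventually below `|V₀| + 1`, so this tolerance makes the total error at
  -- most `ε / 2`; the `+ 1` covers `V₀ = 0`.
  obtain ⟨δ, hδ, hq⟩ := hX.exists_norm_integral_cexp_sub_le (genCov_neg φ₁ φ₂)
    (show 0 < ε / (2 * (|V₀| + 1)) by positivity)
  filter_upwards [hw.eventually_le_const hδ,
    hV.eventually_le_const (show V₀ < |V₀| + 1 by linarith [le_abs_self V₀])] with n hn hVn
  have h := hq (c := fun i : Σ l, sites n l => stencil (i.1 + 1) i.2) (fun i => mass_stencil _ _)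
    (fun i => weight y n i.1) B _ (hbound (sites n)) (hle n) hn
  rw [Real.dist_0_eq_abs, abs_of_nonneg dist_nonneg, dist_comm, dist_eq_norm]
  simp_rw [sum_normalized_eq hX]
  calc _ ≤ _ := h
    _ ≤ ε / (2 * (|V₀| + 1)) * (|V₀| + 1) := by gcongr
    _ = ε / 2 := by field_simp
    _ < ε := half_lt_self hε

end CentralLimitTheorem

end PowerLaw

/-! ### The joint central limit theorem -/

theorem mainTheorem2 {Ω : Type*} [MeasurableSpace Ω] (P : Measure Ω) [IsProbabilityMeasure P]
    (φ₁ φ₂ : ℝ) (hφ₁ : 0 < φ₁) (hφ₂ : 0 < φ₂) (hφ₂' : φ₂ < 1)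
    (X : PowerLaw.Plane → Ω → ℝ)
    (hX : PowerLaw.IsGaussianIRF0 P X (PowerLaw.genCov φ₁ φ₂)) :
    -- `b₂` is the ratio of the squared symbols, and it is at most `16`
    (∀ v : PowerLaw.Plane, PowerLaw.symbol 1 v ≠ 0 →
      PowerLaw.b 1 v = ‖PowerLaw.symbol 2 v‖ ^ 2 / ‖PowerLaw.symbol 1 v‖ ^ 2) ∧
    (∀ v : PowerLaw.Plane, PowerLaw.b 1 v ≤ 16) ∧
    -- the aliasing sum, the means and the covariance integrals exist
    (∀ v : PowerLaw.Plane, Summable fun m : ℤ × ℤ =>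
      PowerLaw.planeDensity φ₁ φ₂ (v + (2 * Real.pi) • PowerLaw.latticePoint m)) ∧
    (∀ n : ℕ, Integrable (PowerLaw.quadVar X 1 n) P ∧ Integrable (PowerLaw.quadVar X 2 n) P) ∧
    (∀ l m : Fin 2, IntegrableOn
      (fun v => PowerLaw.b l v * PowerLaw.b m v * PowerLaw.diffDensity φ₁ φ₂ v ^ 2)
      PowerLaw.torus PowerLaw.specMeasure) ∧
    (PowerLaw.limitCov φ₁ φ₂).PosSemidef ∧
    -- the joint central limit theorem
    TendstoInDistribution (fun n : ℕ => PowerLaw.normalizedVar P X n) atTop id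
      (fun _ => P) (multivariateGaussian 0 (PowerLaw.limitCov φ₁ φ₂)) := by
  have hpos := PowerLaw.posSemidef_limitCov hφ₁ hφ₂ hφ₂'
  refine ⟨fun v => PowerLaw.b_one_eq_div, PowerLaw.b_le 1,
    PowerLaw.summable_planeDensity hφ₁ hφ₂,
    fun n => ⟨hX.integrable_quadVar 1 n, hX.integrable_quadVar 2 n⟩,
    PowerLaw.integrableOn_b_mul_b_mul_diffDensity_sq hφ₁ hφ₂ hφ₂', hpos,
    ⟨hX.aemeasurable_normalizedVar, aemeasurable_id, ?_⟩⟩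
  -- Lévy's continuity theorem reduces convergence in law to pointwise convergence of characteristic
  -- functions.
  refine ProbabilityMeasure.tendsto_iff_tendsto_charFun.2 fun y => ?_
  have h := hX.tendsto_integral_cexp_normalized hφ₁ hφ₂ hφ₂' y
  simp only [ProbabilityMeasure.coe_mk, Measure.map_id]
  rw [charFun_multivariateGaussian hpos, inner_zero_right]
  convert h using 2 with n
  · rw [charFun_apply, integral_map (hX.aemeasurable_normalizedVar n) (by fun_prop)]
    simp_rw [PowerLaw.inner_normalizedVar, mul_comm Complex.I]
  · push_cast
    ring_nf
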